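/- Let $\mathcal M$ be a von Neumann algebra with a faithful, normal, tracial state $\tau$, write $\langle u,v\rangle=\tau(u^*v)$ for the inner product of $L^2(\mathcal M,\tau)\supset\mathcal M$ and $\|\cdot\|_2$ for its norm. For self-adjoint $y\in\mathcal M$, the conjugate variable $\mathcal J(y)$, if it exists, is the unique vector in $L^2(W^*(y))$ with $$\langle \mathcal J(y),y^k\rangle=\langle \mathbf 1\otimes \mathbf 1,\partial_y(y^k)\rangle=\sum_{i=0}^{k-1}\tau(y^i)\,\tau(y^{k-1-i})\qquad\text{for all integers } k\ge 0,$$ where $\partial_y(y^k)=\sum_{i=0}^{k-1}y^i\otimes y^{k-1-i}$ is the free difference quotient. The free Fisher information is $\Phi(y)=\|\mathcal J(y)\|_2^2$ if $\mathcal J(y)$ exists, and $\Phi(y)=\infty$ otherwise. Let $n\in\mathbb N$ and let $x_1,\dots,x_{n+1}\in\mathcal M$ be freely independent self-adjoint elements with $\tau(x_j)=0$ and $\|x_j\|_2=\|x_1\|_2$ for $1\le j\le n+1$. Let $a_1,\dots,a_{n+1}\in\mathbb R$ with $\sum_j a_j^2=1$, and let $b_1,\dots,b_{n+1}\in\mathbb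 R$ with $\sum_j b_j\sqrt{1-a_j^2}=1$. Then $$\Phi\Big(\sum_{j=1}^{n+1}a_jx_j\Big)\le n\sum_{j=1}^{n+1}b_j^2\,\Phi\Big(\tfrac1{\sqrt{1-a_j^2}}\sum_{i\ne j}a_ix_i\Big)\qquad(*)$$ in $[0,\infty]$, with the convention $0\cdot\infty=0$ (if $|a_j|=1$, then the sum over $i\neq j$ vanishes and the corresponding term is read as $b_j^2\,\Phi(0)$, where $\Phi(0)=\infty$). Moreover, if $\Phi(\sum_{i\ne j}a_ix_i)<\infty$ for all $j$ and equality holds in $(*)$, then $\|x_1\|_2>0$, the conjugate variable of $\frac1{\|x_1\|_2}\sum_j a_jx_j$ exists, and $$\mathcal J\Big(\tfrac1{\|x_1\|_2}\sum_{j=1}^{n+1}a_jx_j\Big)=\tfrac1{\|x_1\|_2}\sum_{j=1}^{n+1}a_jx_j ,$$ and $\sum_j a_jx_j$ is $(0,\|x_1\|_2^2)$-semicircular, i.e. with $\gamma=\|x_1\|_2^2$ its distribution with respect to $\tau$ has the density $\frac1{2\pi\gamma}\sqrt{4\gamma-t^2}\;1_{[-2\sqrt\gamma,2\sqrt\gamma]}(t)$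 with respect to Lebesgue measure on $\mathbb R$. -/

import Mathlib

open scoped TensorProduct ComplexOrder ENNReal

/-! ### Tracial states and the space `L²(A, τ)` -/

/-- A faithful tracial state on a unital complex `*`-algebra. -/
structure TracialState (A : Type*) [Ring A] [StarRing A] [Algebra ℂ A] [StarModule ℂ A]
    extends A →ₗ[ℂ] ℂ where
  map_one' : toFun 1 = 1
  nonneg' : ∀ a : A, 0 ≤ toFun (star a * a)
  mul_comm' : ∀ a b : A, toFun (a * b) = toFun (b * a)
  faithful' : ∀ a : A, toFun (star a * a) = 0 → a = 0

namespace TracialState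

variable {A : Type*} [Ring A] [StarRing A] [Algebra ℂ A] [StarModule ℂ A]

instance instCoeFun : CoeFun (TracialState A) (fun _ => A → ℂ) := ⟨fun τ => τ.toLinearMap⟩

theorem nonneg (τ : TracialState A) (a : A) : 0 ≤ τ (star a * a) := τ.nonneg' a

/-- A positive functional is hermitian. -/
theorem map_star (τ : TracialState A) (a : A) : τ (star a) = starRingEnd ℂ (τ a) := by
  have e1 : τ (1 : A) = 1 := τ.map_one'
  have h0 := (Complex.nonneg_iff.mp (τ.nonneg a)).2
  have h1 := (Complex.nonneg_iff.mp (τ.nonneg (1 + a))).2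
  have h2 := (Complex.nonneg_iff.mp (τ.nonneg (1 + Complex.I • a))).2
  have k1 : star (1 + a) * (1 + a) = 1 + a + star a + star a * a := by
    simp only [star_add, star_one]; noncomm_ring
  have k2 : star (1 + Complex.I • a) * (1 + Complex.I • a)
      = 1 + Complex.I • a - Complex.I • star a + star a * a := by
    have hs : star (1 + Complex.I • a) = 1 - Complex.I • star a := by
      simp [sub_eq_add_neg]
    rw [hs, sub_mul, one_mul, mul_add, mul_one, smul_mul_smul_comm, Complex.I_mul_I, neg_one_smul]
    abel
  rw [k1] at h1
  rw [k2] at h2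
  simp only [map_add, map_sub, map_smul, e1, Complex.add_im, Complex.sub_im, Complex.one_im,
    smul_eq_mul, Complex.mul_im, Complex.I_re, Complex.I_im] at h0 h1 h2
  apply Complex.ext
  · simp only [Complex.conj_re]; linarith
  · simp only [Complex.conj_im]; linarith

set_option linter.unusedVariables false in
/-- The algebra `A`, to be equipped with the inner product `⟨a, b⟩ = τ(a* b)`. -/
@[nolint unusedArguments]
def PreL2 (τ : TracialState A) : Type _ := A

instance (τ : TracialState A) : AddCommGroup τ.PreL2 := inferInstanceAs (AddCommGroup A)
instance (τ : TracialState A) : Module ℂ τ.PreL2 := inferInstanceAs (Module ℂ A)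

/-- The identity map from `A` to its pre-Hilbert version. -/
def toPreL2 (τ : TracialState A) : A ≃ₗ[ℂ] τ.PreL2 := LinearEquiv.refl ℂ _

/-- The inner product `⟨a, b⟩ = τ(a* b)`. -/
noncomputable abbrev preL2Core (τ : TracialState A) : InnerProductSpace.Core ℂ τ.PreL2 where
  inner a b := τ (star (τ.toPreL2.symm a) * τ.toPreL2.symm b)
  conj_inner_symm a b := by rw [← τ.map_star]; simp
  re_inner_nonneg a := (RCLike.nonneg_iff.mp (τ.nonneg (τ.toPreL2.symm a))).1
  add_left a b c := by simp [add_mul]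
  smul_left a b r := by simp
  definite a h := by
    have := τ.faithful' _ h
    simpa using this

noncomputable instance (τ : TracialState A) : NormedAddCommGroup τ.PreL2 :=
  InnerProductSpace.Core.toNormedAddCommGroup (cd := τ.preL2Core)

noncomputable instance (τ : TracialState A) : InnerProductSpace ℂ τ.PreL2 :=
  InnerProductSpace.ofCore τ.preL2Core.toCore

/-- The Hilbert space `L²(A, τ)`. -/
abbrev L2 (τ : TracialState A) : Type _ := UniformSpace.Completion τ.PreL2

/-- The canonical map `A → L²(A, τ)`. -/
noncomputable def toL2 (τ : TracialState A) : A →ₗ[ℂ] τ.L2 :=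
  (UniformSpace.Completion.toComplₗᵢ (𝕜 := ℂ) (E := τ.PreL2)).toLinearMap ∘ₗ
    τ.toPreL2.toLinearMap

theorem inner_toL2 (τ : TracialState A) (a b : A) :
    inner ℂ (τ.toL2 a) (τ.toL2 b) = τ (star a * b) :=
  (UniformSpace.Completion.toComplₗᵢ (𝕜 := ℂ) (E := τ.PreL2)).inner_map_map _ _

/-! ### Free independence and distributions -/

/-- Free independence of a family of unital `*`-subalgebras: alternating products of centered
elements are centered. -/
def FreeSubalgebras (τ : TracialState A) {ι : Type*} (B : ι → StarSubalgebra ℂ A) : Prop :=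
  ∀ w : List (ι × A), w ≠ [] → w.IsChain (fun p q => p.1 ≠ q.1) →
    (∀ p ∈ w, p.2 ∈ B p.1 ∧ τ p.2 = 0) → τ (w.map Prod.snd).prod = 0

/-- Free independence of a family of elements: the unital `*`-subalgebras that they generate are
freely independent. -/
def FreelyIndependent (τ : TracialState A) {ι : Type*} (x : ι → A) : Prop :=
  τ.FreeSubalgebras fun i => StarAlgebra.adjoin ℂ {x i}

/-- The compactly supported probability measure `μ` on `ℝ` is the distribution of the (self-adjoint)
element `y`, that is, `∫ tᵏ dμ(t) = τ(yᵏ)` for all `k`. -/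
def HasDistribution (τ : TracialState A) (y : A) (μ : MeasureTheory.Measure ℝ) : Prop :=
  MeasureTheory.IsProbabilityMeasure μ ∧ (∃ R : ℝ, μ (Set.Icc (-R) R)ᶜ = 0) ∧
    ∀ k : ℕ, ((∫ t, t ^ k ∂μ : ℝ) : ℂ) = τ (y ^ k)

end TracialState

/-- The semicircle law with mean `m` and variance `γ` (for `γ > 0`). -/
noncomputable def semicircleLaw (m γ : ℝ) : MeasureTheory.Measure ℝ :=
  MeasureTheory.volume.withDensity fun t =>
    ENNReal.ofReal ((Set.Icc (m - 2 * √γ) (m + 2 * √γ)).indicator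
      (fun t => 1 / (2 * Real.pi * γ) * √(4 * γ - (t - m) ^ 2)) t)

/-- The element `y` is `(m, γ)`-semicircular. -/
def TracialState.IsSemicircular {A : Type*} [Ring A] [StarRing A] [Algebra ℂ A] [StarModule ℂ A]
    (τ : TracialState A) (y : A) (m γ : ℝ) : Prop :=
  0 < γ ∧ τ.HasDistribution y (semicircleLaw m γ)

/-! ### The free difference quotient -/

/-- The free difference quotient `∂ : ℂ[X] → ℂ[X] ⊗ ℂ[X]`, the derivation with `∂ 1 = 0` and
`∂ X = 1 ⊗ 1`. -/
noncomputable def freeDiff :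
    Polynomial ℂ →ₗ[ℂ] Polynomial ℂ ⊗[ℂ] Polynomial ℂ :=
  (Polynomial.basisMonomials ℂ).constr ℂ fun k =>
    ∑ i ∈ Finset.range k, (Polynomial.X ^ i) ⊗ₜ[ℂ] (Polynomial.X ^ (k - 1 - i))

theorem freeDiff_X_pow (k : ℕ) :
    freeDiff (Polynomial.X ^ k) =
      ∑ i ∈ Finset.range k, (Polynomial.X ^ i) ⊗ₜ[ℂ] (Polynomial.X ^ (k - 1 - i)) := by
  have h := (Polynomial.basisMonomials ℂ).constr_basis ℂ (fun k =>
    ∑ i ∈ Finset.range k,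
      (Polynomial.X ^ i : Polynomial ℂ) ⊗ₜ[ℂ] (Polynomial.X ^ (k - 1 - i) : Polynomial ℂ)) k
  simpa [freeDiff, Polynomial.coe_basisMonomials, Polynomial.monomial_one_right_eq_X_pow] using h

theorem freeDiff_one : freeDiff 1 = 0 := by
  simpa using freeDiff_X_pow 0

theorem freeDiff_X : freeDiff Polynomial.X = 1 ⊗ₜ[ℂ] 1 := by
  simpa using freeDiff_X_pow 1

theorem freeDiff_mul (p q : Polynomial ℂ) :
    freeDiff (p * q) = freeDiff p * (1 ⊗ₜ[ℂ] q) + (p ⊗ₜ[ℂ] 1) * freeDiff q := by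
  have hmon : ∀ k l : ℕ, freeDiff (Polynomial.X ^ k * Polynomial.X ^ l) =
      freeDiff (Polynomial.X ^ k) * (1 ⊗ₜ[ℂ] (Polynomial.X ^ l)) +
        ((Polynomial.X ^ k) ⊗ₜ[ℂ] 1) * freeDiff (Polynomial.X ^ l) := by
    intro k l
    rw [← pow_add, freeDiff_X_pow, freeDiff_X_pow, freeDiff_X_pow, Finset.sum_range_add,
      Finset.sum_mul, Finset.mul_sum]
    congr 1
    · refine Finset.sum_congr rfl fun i hi => ?_
      have hi := Finset.mem_range.mp hi
      rw [Algebra.TensorProduct.tmul_mul_tmul, mul_one, ← pow_add]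
      congr 2
      omega
    · refine Finset.sum_congr rfl fun i hi => ?_
      have hi := Finset.mem_range.mp hi
      rw [Algebra.TensorProduct.tmul_mul_tmul, one_mul, ← pow_add]
      congr 2
      omega
  induction p using Polynomial.induction_on' with
  | add p₁ p₂ h₁ h₂ =>
    simp only [add_mul, map_add, h₁, h₂, TensorProduct.add_tmul]
    abel
  | monomial k c =>
    induction q using Polynomial.induction_on' with
    | add q₁ q₂ h₁ h₂ =>
      simp only [mul_add, map_add, h₁, h₂, TensorProduct.tmul_add]
      abel
    | monomial l d =>
      simp only [← Polynomial.smul_X_eq_monomial, smul_mul_assoc, mul_smul_comm, map_smul, hmon,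
        TensorProduct.tmul_smul, ← TensorProduct.smul_tmul', smul_add]

/-! ### Von Neumann algebras, conjugate variables and free Fisher information -/

section VonNeumann

variable {H : Type*} [NormedAddCommGroup H] [InnerProductSpace ℂ H] [CompleteSpace H]

/-- The von Neumann algebra `W*(S)` generated by a set `S` of bounded operators: the double
commutant of `S ∪ S*`. -/
noncomputable def vonNeumannGenerated (S : Set (H →L[ℂ] H)) : VonNeumannAlgebra H where
  toStarSubalgebra := StarSubalgebra.centralizer ℂ
    ((StarSubalgebra.centralizer ℂ S : StarSubalgebra ℂ (H →L[ℂ] H)) : Set (H →L[ℂ] H))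
  centralizer_centralizer' := by
    change Set.centralizer (Set.centralizer ((StarSubalgebra.centralizer ℂ
      ((StarSubalgebra.centralizer ℂ S : StarSubalgebra ℂ (H →L[ℂ] H)) : Set (H →L[ℂ] H)) :
        StarSubalgebra ℂ (H →L[ℂ] H)) : Set (H →L[ℂ] H))) =
      ((StarSubalgebra.centralizer ℂ
      ((StarSubalgebra.centralizer ℂ S : StarSubalgebra ℂ (H →L[ℂ] H)) : Set (H →L[ℂ] H)) :
        StarSubalgebra ℂ (H →L[ℂ] H)) : Set (H →L[ℂ] H))
    rw [StarSubalgebra.coe_centralizer, Set.centralizer_centralizer_centralizer]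

variable {M : VonNeumannAlgebra H}

namespace TracialState

/-- Normality, that is, continuity in the ultraweak topology: `τ` is of the form
`a ↦ ∑ₙ ⟨ξₙ, a ηₙ⟩` with `∑ₙ ‖ξₙ‖² < ∞` and `∑ₙ ‖ηₙ‖² < ∞`. -/
def IsNormal (τ : TracialState M.toStarSubalgebra) : Prop :=
  ∃ ξ η : ℕ → H, Summable (fun n => ‖ξ n‖ ^ 2) ∧ Summable (fun n => ‖η n‖ ^ 2) ∧
    ∀ a : M.toStarSubalgebra, HasSum (fun n => inner ℂ (ξ n) ((a : H →L[ℂ] H) (η n))) (τ a)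

/-- The closed subspace `L²(W*(y))` of `L²(M, τ)`, for `y` in `M`. -/
noncomputable def L2Generated (τ : TracialState M.toStarSubalgebra) (y : M.toStarSubalgebra) :
    Set τ.L2 :=
  closure (τ.toL2 '' {z | (z : H →L[ℂ] H) ∈ vonNeumannGenerated {(y : H →L[ℂ] H)}})

/-- The evaluation `p ↦ p(y)` as a map from polynomials to `L²(M, τ)`. -/
noncomputable def evalL2 (τ : TracialState M.toStarSubalgebra) (y : M.toStarSubalgebra) :
    Polynomial ℂ →ₗ[ℂ] τ.L2 :=
  τ.toL2 ∘ₗ (Polynomial.aeval y).toLinearMap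

/-- `ξ` is the conjugate variable `𝒥(y)` of `y`: it lies in `L²(W*(y))`, and
`⟨ξ, yᵏ⟩ = ⟨1 ⊗ 1, ∂_y (yᵏ)⟩` for all `k`. -/
def IsConjugateVariable (τ : TracialState M.toStarSubalgebra) (y : M.toStarSubalgebra)
    (ξ : τ.L2) : Prop :=
  ξ ∈ τ.L2Generated y ∧
    ∀ k : ℕ, inner ℂ ξ (τ.toL2 (y ^ k)) =
      inner ℂ (τ.toL2 1 ⊗ₜ[ℂ] τ.toL2 1)
        (TensorProduct.map (τ.evalL2 y) (τ.evalL2 y) (freeDiff (Polynomial.X ^ k)))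

/-- The free Fisher information `Φ(y) = ‖𝒥(y)‖²` of `y`, equal to `∞` if `y` has no conjugate
variable. (A conjugate variable is unique, so the infimum is over at most one vector.) -/
noncomputable def freeFisher (τ : TracialState M.toStarSubalgebra) (y : M.toStarSubalgebra) :
    ℝ≥0∞ :=
  ⨅ (ξ : τ.L2) (_ : τ.IsConjugateVariable y ξ), ‖ξ‖ₑ ^ 2

end TracialState

end VonNeumann

/-!
For a partial sum `y j = ∑_{i ≠ j} aᵢ xᵢ`, the conjugate variable `ξ j` of `y j` also satisfies the
conjugate relation of `S = ∑ aᵢ xᵢ`, because `aⱼ xⱼ` is free from `y j` (`ConjRel.of_erase`). Hence so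
does every combination of the `ξ j` with coefficients of sum one; the coefficients
`b j * √(1 - a j ^ 2)` give the vector `V = ∑ v j`, where `v j` is `b j` times the conjugate variable
of the normalized partial sum (`exists_conjRel_sum`). The free Fisher information of `S` is the
squared norm of the projection of `V` onto `L²` of the polynomials in `S` (`ConjRel.freeFisher_eq`).

By freeness, `L²` of the algebra generated by the `xᵢ` decomposes orthogonally according to the set of
labels that occur in alternating centered words (`map_star_wordProd_mul_eq_zero`). The vector `v j` is
centered and has no component at the label sets that contain `j`. So at most `n` of the `n + 1`
vectors `v j` have a component at a given label set, and the Cauchy–Schwarz inequality gives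
`‖∑ v j‖² ≤ n ∑ ‖v j‖²` (`norm_sq_sum_le`), which is the asserted inequality.

If equality holds, then `V` is the conjugate variable of `S`, and it has no component at label sets
with at least two elements. Like all vectors in `L²` of the polynomials in `S`, it commutes with `S`.
Comparing the components of `S V` and `V S` in the words with two different labels shows that `V` is a
multiple of `S` (`eq_smul_toL2_sum`), and the conjugate relation fixes the factor. The conjugate
relation is then a recursion for the moments of `S`, which the moments of the semicircle law satisfy
by the recursion of the Catalan numbers (`integral_pow_semicircleLaw_eq`).

Throughout, the algebra acts on `L²` only through inner products with elements of the algebra, and the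
space `L²(W*(y))` is replaced by the closure of the polynomials in `y`: projecting onto the latter
preserves the conjugate relation and does not increase the norm.
-/

/-! ### Alternating centered words -/

section Words

variable {ι R : Type*} [Ring R]

/-- The product of the entries of a word. -/
def wordProd (l : List (ι × R)) : R := (l.map Prod.snd).prod

@[simp] theorem wordProd_nil : wordProd ([] : List (ι × R)) = 1 := rfl

@[simp] theorem wordProd_cons (p : ι × R) (l : List (ι × R)) :
    wordProd (p :: l) = p.2 * wordProd l := by
  simp [wordProd]

@[simp] theorem wordProd_append (l m : List (ι × R)) :
    wordProd (l ++ m) = wordProd l * wordProd m := by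
  simp [wordProd]

theorem star_wordProd [StarRing R] (l : List (ι × R)) :
    star (wordProd l) = wordProd (l.map fun p => (p.1, star p.2)).reverse := by
  induction l with
  | nil => simp
  | cons p l ih => simp [ih]

variable [Algebra ℂ R]

/-- A list of labelled elements is an alternating centered word if neighbouring labels are
different, and every entry lies in the subalgebra named by its label and is killed by the
functional `ε`. -/
def IsAltWord (L : ι → Subalgebra ℂ R) (ε : R →ₗ[ℂ] ℂ) (l : List (ι × R)) : Prop :=
  l.IsChain (fun p q => p.1 ≠ q.1) ∧ ∀ p ∈ l, p.2 ∈ L p.1 ∧ ε p.2 = 0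

/-- The span of the alternating centered words with labels in `T`. -/
def altSpan (L : ι → Subalgebra ℂ R) (ε : R →ₗ[ℂ] ℂ) (T : Set ι) : Submodule ℂ R :=
  Submodule.span ℂ {r | ∃ l, IsAltWord L ε l ∧ (∀ p ∈ l, p.1 ∈ T) ∧ wordProd l = r}

variable {L : ι → Subalgebra ℂ R} {ε : R →ₗ[ℂ] ℂ} {T : Set ι}

namespace IsAltWord

theorem nil : IsAltWord L ε [] := ⟨List.IsChain.nil, by simp⟩

theorem cons {p : ι × R} {l : List (ι × R)} (hl : IsAltWord L ε l) (hp : p.2 ∈ L p.1)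
    (h0 : ε p.2 = 0) (hne : ∀ q ∈ l.head?, p.1 ≠ q.1) : IsAltWord L ε (p :: l) := by
  refine ⟨List.isChain_cons.mpr ⟨hne, hl.1⟩, ?_⟩
  intro q hq
  rcases List.mem_cons.mp hq with rfl | hq
  · exact ⟨hp, h0⟩
  · exact hl.2 q hq

theorem tail {p : ι × R} {l : List (ι × R)} (h : IsAltWord L ε (p :: l)) : IsAltWord L ε l :=
  ⟨(List.isChain_cons.mp h.1).2, fun q hq => h.2 q (List.mem_cons_of_mem _ hq)⟩

theorem append {l m : List (ι × R)} (hl : IsAltWord L ε l) (hm : IsAltWord L ε m)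
    (hne : ∀ p ∈ l.getLast?, ∀ q ∈ m.head?, p.1 ≠ q.1) : IsAltWord L ε (l ++ m) := by
  refine ⟨List.isChain_append.mpr ⟨hl.1, hm.1, hne⟩, fun q hq => ?_⟩
  rcases List.mem_append.mp hq with hq | hq
  exacts [hl.2 q hq, hm.2 q hq]

theorem left_of_append {l m : List (ι × R)} (h : IsAltWord L ε (l ++ m)) : IsAltWord L ε l :=
  ⟨(List.isChain_append.mp h.1).1, fun q hq => h.2 q (List.mem_append_left _ hq)⟩

end IsAltWord

theorem wordProd_mem_altSpan {l : List (ι × R)} (hl : IsAltWord L ε l) (hT : ∀ p ∈ l, p.1 ∈ T) :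
    wordProd l ∈ altSpan L ε T :=
  Submodule.subset_span ⟨l, hl, hT, rfl⟩

theorem one_mem_altSpan : (1 : R) ∈ altSpan L ε T :=
  wordProd_mem_altSpan (l := []) IsAltWord.nil (by simp)

/-- An entry whose label differs from the first label of a word may be put in front of it after
centering. -/
theorem mul_wordProd_mem_altSpan_of_ne (hε : ε 1 = 1) {i : ι} (hi : i ∈ T) {e : R} (he : e ∈ L i)
    {l : List (ι × R)} (hl : IsAltWord L ε l) (hT : ∀ p ∈ l, p.1 ∈ T)
    (hne : ∀ q ∈ l.head?, i ≠ q.1) : e * wordProd l ∈ altSpan L ε T := by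
  have key : e * wordProd l = wordProd ((i, e - algebraMap ℂ R (ε e)) :: l) + ε e • wordProd l := by
    simp [sub_mul, Algebra.smul_def]
  rw [key]
  refine add_mem (wordProd_mem_altSpan (hl.cons ?_ ?_ hne) ?_)
    (Submodule.smul_mem _ _ (wordProd_mem_altSpan hl hT))
  · exact sub_mem he (Subalgebra.algebraMap_mem _ _)
  · simp [Algebra.algebraMap_eq_smul_one, hε]
  · intro q hq
    rcases List.mem_cons.mp hq with rfl | hq
    exacts [hi, hT q hq]

theorem mul_mem_altSpan (hε : ε 1 = 1) {i : ι} (hi : i ∈ T) {e : R} (he : e ∈ L i)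
    {r : R} (hr : r ∈ altSpan L ε T) : e * r ∈ altSpan L ε T := by
  induction hr using Submodule.span_induction with
  | zero => simp
  | add x y _ _ hx hy => rw [mul_add]; exact add_mem hx hy
  | smul c x _ hx => rw [mul_smul_comm]; exact Submodule.smul_mem _ _ hx
  | mem x hx =>
    obtain ⟨l, hl, hT, rfl⟩ := hx
    cases l with
    | nil => exact mul_wordProd_mem_altSpan_of_ne hε hi he hl hT (by simp)
    | cons p l =>
      by_cases hp : i = p.1
      · subst hp
        rw [wordProd_cons, ← mul_assoc]
        exact mul_wordProd_mem_altSpan_of_ne hε hi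
          (mul_mem he (hl.2 p List.mem_cons_self).1) hl.tail
          (fun q hq => hT q (List.mem_cons_of_mem _ hq)) (List.isChain_cons.mp hl.1).1
      · exact mul_wordProd_mem_altSpan_of_ne hε hi he hl hT (by simpa using hp)

/-- The subalgebra generated by the subalgebras with labels in `T`. -/
def groupAlg (L : ι → Subalgebra ℂ R) (T : Set ι) : Subalgebra ℂ R :=
  Algebra.adjoin ℂ (⋃ i ∈ T, (L i : Set R))

theorem mem_groupAlg {i : ι} (hi : i ∈ T) {e : R} (he : e ∈ L i) : e ∈ groupAlg L T :=
  Algebra.subset_adjoin (Set.mem_biUnion hi he)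

/-- A subalgebra generated by the letters is spanned by the alternating centered words. -/
theorem groupAlg_le_altSpan (hε : ε 1 = 1) {r : R} (hr : r ∈ groupAlg L T) :
    r ∈ altSpan L ε T := by
  suffices h : ∀ s ∈ altSpan L ε T, r * s ∈ altSpan L ε T by
    simpa using h 1 one_mem_altSpan
  induction hr using Algebra.adjoin_induction with
  | mem x hx =>
    obtain ⟨i, hi, hx⟩ := Set.mem_iUnion₂.mp hx
    exact fun s hs => mul_mem_altSpan hε hi hx hs
  | algebraMap c =>
    intro s hs
    rw [← Algebra.smul_def]
    exact Submodule.smul_mem _ _ hs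
  | add x y _ _ hx hy => intro s hs; rw [add_mul]; exact add_mem (hx s hs) (hy s hs)
  | mul x y _ _ hx hy => intro s hs; rw [mul_assoc]; exact hx _ (hy s hs)

/-- If all nonempty alternating centered words are killed by `ε`, then a centered element of a
generated subalgebra is a combination of nonempty words. -/
theorem mem_span_nonempty_words (hε : ε 1 = 1)
    (hfree : ∀ l, l ≠ [] → IsAltWord L ε l → ε (wordProd l) = 0) {r : R} (hr : r ∈ groupAlg L T)
    (h0 : ε r = 0) :
    r ∈ Submodule.span ℂ
      {s | ∃ l, l ≠ [] ∧ IsAltWord L ε l ∧ (∀ p ∈ l, p.1 ∈ T) ∧ wordProd l = s} := by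
  suffices h : ∀ r ∈ altSpan L ε T, r - ε r • 1 ∈ Submodule.span ℂ
      {s | ∃ l, l ≠ [] ∧ IsAltWord L ε l ∧ (∀ p ∈ l, p.1 ∈ T) ∧ wordProd l = s} by
    simpa [h0] using h r (groupAlg_le_altSpan hε hr)
  intro r hr
  induction hr using Submodule.span_induction with
  | zero => simp
  | add x y _ _ hx hy =>
    have := add_mem hx hy
    rwa [show x - ε x • (1 : R) + (y - ε y • 1) = x + y - ε (x + y) • 1 by
      rw [map_add, add_smul]; abel] at this
  | smul c x _ hx =>
    have := Submodule.smul_mem _ c hx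
    rwa [show c • (x - ε x • (1 : R)) = c • x - ε (c • x) • 1 by
      rw [map_smul, smul_sub, smul_assoc]] at this
  | mem x hx =>
    obtain ⟨l, hl, hT, rfl⟩ := hx
    by_cases hn : l = []
    · subst hn; simp [hε]
    · rw [hfree l hn hl, zero_smul, sub_zero]
      exact Submodule.subset_span ⟨l, hn, hl, hT, rfl⟩

/-- Freeness is associative: if the labels are grouped by a map `π`, then the subalgebras generated
by the groups are again free. -/
theorem wordProd_group_eq_zero {κ : Type*} (π : ι → κ) (hε : ε 1 = 1)
    (hfree : ∀ l, l ≠ [] → IsAltWord L ε l → ε (wordProd l) = 0) (w : List (κ × R)) (hw : w ≠ [])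
    (hw' : IsAltWord (fun k => groupAlg L (π ⁻¹' {k})) ε w) : ε (wordProd w) = 0 := by
  -- The product of a word in the groups is a combination of words in the original labels whose
  -- first label belongs to the first group.
  have key : ∀ w : List (κ × R), IsAltWord (fun k => groupAlg L (π ⁻¹' {k})) ε w →
      wordProd w ∈ Submodule.span ℂ {s | ∃ l, IsAltWord L ε l ∧
        l.head?.map (fun p => π p.1) = w.head?.map Prod.fst ∧ wordProd l = s} := by
    intro w
    induction w with
    | nil => intro _; exact Submodule.subset_span ⟨[], IsAltWord.nil, by simp, rfl⟩
    | cons p w ih =>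
      intro h
      have h1 := mem_span_nonempty_words hε hfree (h.2 p List.mem_cons_self).1
        (h.2 p List.mem_cons_self).2
      have h2 := ih h.tail
      rw [wordProd_cons]
      have h3 := Submodule.mul_mem_mul h1 h2
      rw [Submodule.span_mul_span] at h3
      refine Submodule.span_mono ?_ h3
      rintro _ ⟨_, ⟨l, hln, hl, hlT, rfl⟩, _, ⟨m, hm, hmh, rfl⟩, rfl⟩
      refine ⟨l ++ m, hl.append hm ?_, ?_, wordProd_append l m⟩
      · intro q hq q' hq' hqq
        have e1 : π q.1 = p.1 := hlT q (List.mem_of_mem_getLast? hq)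
        rw [Option.mem_def] at hq'
        rw [hq'] at hmh
        obtain ⟨q'', hq'', e2⟩ := Option.map_eq_some_iff.mp hmh.symm
        refine (List.isChain_cons.mp h.1).1 q'' hq'' ?_
        rw [e2, ← e1, hqq]
      · cases l with
        | nil => exact absurd rfl hln
        | cons q l => simpa using hlT q List.mem_cons_self
  have hmem := key w hw'
  have hne : w.head?.map Prod.fst ≠ none := by
    cases w with
    | nil => exact absurd rfl hw
    | cons p w => simp
  generalize wordProd w = r at hmem
  induction hmem using Submodule.span_induction with
  | zero => simp
  | add x y _ _ hx hy => rw [map_add, hx, hy, add_zero]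
  | smul c x _ hx => rw [map_smul, hx, smul_zero]
  | mem x hx =>
    obtain ⟨l, hl, hh, rfl⟩ := hx
    refine hfree l ?_ hl
    rintro rfl
    exact hne (by simpa using hh.symm)

end Words

/-! ### The free difference quotient along a free sum -/

section FreeSum

variable {A : Type*} [Ring A] [Algebra ℂ A]

/-- The matrix `(f ⊗ 1, t; 0, 1 ⊗ f)`. A derivation `∂ : A → A ⊗ A` corresponds to the algebra
homomorphism `f ↦ tri f (∂ f)`. -/
def tri (f : A) (t : A ⊗[ℂ] A) : Matrix (Fin 2) (Fin 2) (A ⊗[ℂ] A) :=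
  !![f ⊗ₜ 1, t; 0, 1 ⊗ₜ f]

theorem tri_mul (f g : A) (t s : A ⊗[ℂ] A) :
    tri f t * tri g s = tri (f * g) ((f ⊗ₜ 1) * s + t * (1 ⊗ₜ g)) := by
  simp [tri]

theorem tri_add (f g : A) (t s : A ⊗[ℂ] A) : tri f t + tri g s = tri (f + g) (t + s) := by
  ext i j
  fin_cases i <;> fin_cases j <;> simp [tri, TensorProduct.add_tmul, TensorProduct.tmul_add]

theorem tri_smul (c : ℂ) (f : A) (t : A ⊗[ℂ] A) : c • tri f t = tri (c • f) (c • t) := by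
  ext i j
  fin_cases i <;> fin_cases j <;> simp [tri, TensorProduct.smul_tmul']

theorem tri_one : tri (1 : A) 0 = 1 := by
  ext i j
  fin_cases i <;> fin_cases j <;> simp [tri, Algebra.TensorProduct.one_def]

theorem tri_pow (y : A) (k : ℕ) :
    tri y (1 ⊗ₜ 1) ^ k = tri (y ^ k) (∑ i ∈ Finset.range k, (y ^ i) ⊗ₜ[ℂ] (y ^ (k - 1 - i))) := by
  induction k with
  | zero => simp [tri_one]
  | succ k ih =>
    rw [pow_succ', ih, tri_mul, ← pow_succ']
    congr 1
    rw [Finset.sum_range_succ', Finset.mul_sum]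
    congr 1
    · refine Finset.sum_congr rfl fun i _ => ?_
      rw [Algebra.TensorProduct.tmul_mul_tmul, one_mul, ← pow_succ']
      congr 2
      omega
    · simp

theorem tri_zero_pow (x : A) (k : ℕ) : tri x 0 ^ k = tri (x ^ k) 0 := by
  induction k with
  | zero => simp [tri_one]
  | succ k ih => rw [pow_succ', ih, tri_mul, ← pow_succ']; simp

/-- A property of matrices that is stable under linear combinations and holds for the powers of `Y`
holds on the algebra generated by `Y`. -/
theorem adjoin_singleton_induction {R : Type*} [Ring R] [Algebra ℂ R] {Y : R} {P : R → Prop}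
    (hadd : ∀ a b, P a → P b → P (a + b)) (hsmul : ∀ (c : ℂ) a, P a → P (c • a))
    (hpow : ∀ k, P (Y ^ k)) {r : R} (hr : r ∈ Algebra.adjoin ℂ {Y}) : P r := by
  rw [Algebra.adjoin_singleton_eq_range_aeval] at hr
  obtain ⟨p, rfl⟩ := hr
  induction p using Polynomial.induction_on' with
  | add p q hp hq => simpa using hadd _ _ hp hq
  | monomial k c => simpa [Polynomial.aeval_monomial, ← Algebra.smul_def] using hsmul c _ (hpow k)

variable (τ : A →ₗ[ℂ] ℂ)

/-- The functional `τ ⊗ τ`. -/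
noncomputable def tensorSq : A ⊗[ℂ] A →ₗ[ℂ] ℂ :=
  LinearMap.mul' ℂ ℂ ∘ₗ TensorProduct.map τ τ

@[simp] theorem tensorSq_tmul (a b : A) : tensorSq τ (a ⊗ₜ b) = τ a * τ b := by
  simp [tensorSq]

/-- The linear map with `f ⊗ 1 ↦ f`, applied to the upper left corner of a matrix. -/
noncomputable def triBase : Matrix (Fin 2) (Fin 2) (A ⊗[ℂ] A) →ₗ[ℂ] A :=
  (TensorProduct.lift (LinearMap.flip (LinearMap.lsmul ℂ A ∘ₗ τ))) ∘ₗ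
    Matrix.entryLinearMap ℂ (A ⊗[ℂ] A) 0 0

theorem triBase_tri (hτ : τ 1 = 1) (f : A) (t : A ⊗[ℂ] A) : triBase τ (tri f t) = f := by
  simp [triBase, tri, hτ]

/-- The letters over `y` (label `true`) and over `x` (label `false`): the algebra homomorphisms
`f ↦ tri f (∂ f)` on polynomials in `y`, and `f ↦ tri f 0` on polynomials in `x`. -/
def triLetters (y x : A) : Bool → Subalgebra ℂ (Matrix (Fin 2) (Fin 2) (A ⊗[ℂ] A))
  | true => Algebra.adjoin ℂ {tri y (1 ⊗ₜ 1)}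
  | false => Algebra.adjoin ℂ {tri x 0}

/-- The algebras of polynomials in `y` (label `true`) and in `x` (label `false`). -/
def pairAlg (y x : A) : Bool → Subalgebra ℂ A
  | true => Algebra.adjoin ℂ {y}
  | false => Algebra.adjoin ℂ {x}

variable {τ} {y x : A}

theorem exists_of_mem_triLetters_true {r : Matrix (Fin 2) (Fin 2) (A ⊗[ℂ] A)}
    (hr : r ∈ triLetters y x true) : ∃ f t, r = tri f t ∧ f ∈ Algebra.adjoin ℂ {y} ∧
      t ∈ Submodule.span ℂ {s | ∃ g ∈ Algebra.adjoin ℂ {y}, ∃ h ∈ Algebra.adjoin ℂ {y},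
        g ⊗ₜ[ℂ] h = s} ∧
      ∀ φ : A →ₗ[ℂ] ℂ,
        (∀ k : ℕ, φ (y ^ k) = ∑ i ∈ Finset.range k, τ (y ^ i) * τ (y ^ (k - 1 - i))) →
          φ f = tensorSq τ t := by
  refine adjoin_singleton_induction (P := fun r => ∃ f t, r = tri f t ∧
    f ∈ Algebra.adjoin ℂ {y} ∧
      t ∈ Submodule.span ℂ {s | ∃ g ∈ Algebra.adjoin ℂ {y}, ∃ h ∈ Algebra.adjoin ℂ {y},
        g ⊗ₜ[ℂ] h = s} ∧
      ∀ φ : A →ₗ[ℂ] ℂ,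
        (∀ k : ℕ, φ (y ^ k) = ∑ i ∈ Finset.range k, τ (y ^ i) * τ (y ^ (k - 1 - i))) →
          φ f = tensorSq τ t) ?_ ?_ ?_ hr
  · rintro _ _ ⟨f, t, rfl, hf, ht, h⟩ ⟨g, s, rfl, hg, hs, h'⟩
    refine ⟨f + g, t + s, tri_add .., add_mem hf hg, add_mem ht hs, fun φ hφ => ?_⟩
    rw [map_add, map_add, h φ hφ, h' φ hφ]
  · rintro c _ ⟨f, t, rfl, hf, ht, h⟩
    refine ⟨c • f, c • t, tri_smul .., Subalgebra.smul_mem _ hf c, Submodule.smul_mem _ _ ht,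
      fun φ hφ => ?_⟩
    rw [map_smul, map_smul, h φ hφ]
  · intro k
    have hy : y ∈ Algebra.adjoin ℂ {y} := Algebra.self_mem_adjoin_singleton ℂ y
    refine ⟨_, _, tri_pow y k, pow_mem hy k, sum_mem fun i _ => Submodule.subset_span
      ⟨_, pow_mem hy _, _, pow_mem hy _, rfl⟩, fun φ hφ => ?_⟩
    rw [hφ k, map_sum]
    simp

theorem exists_of_mem_triLetters_false {r : Matrix (Fin 2) (Fin 2) (A ⊗[ℂ] A)}
    (hr : r ∈ triLetters y x false) : ∃ f, r = tri f 0 ∧ f ∈ Algebra.adjoin ℂ {x} := by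
  refine adjoin_singleton_induction (P := fun r => ∃ f, r = tri f 0 ∧
    f ∈ Algebra.adjoin ℂ {x}) ?_ ?_ ?_ hr
  · rintro _ _ ⟨f, rfl, hf⟩ ⟨g, rfl, hg⟩
    exact ⟨f + g, by rw [tri_add, add_zero], add_mem hf hg⟩
  · rintro c _ ⟨f, rfl, hf⟩
    exact ⟨c • f, by rw [tri_smul, smul_zero], Subalgebra.smul_mem _ hf c⟩
  · intro k
    exact ⟨_, tri_zero_pow x k, pow_mem (Algebra.self_mem_adjoin_singleton ℂ x) k⟩

/-- In a free family, a nonempty word times an element with a different label is centered. -/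
theorem map_wordProd_mul_eq_zero {ι : Type*} {L : ι → Subalgebra ℂ A} (hτ : τ 1 = 1)
    (hfree : ∀ l, l ≠ [] → IsAltWord L τ l → τ (wordProd l) = 0)
    {u : List (ι × A)} (hu : u ≠ []) (hua : IsAltWord L τ u) {i : ι}
    (hne : ∀ p ∈ u.getLast?, p.1 ≠ i) {f : A} (hf : f ∈ L i) : τ (wordProd u * f) = 0 := by
  have h1 := hfree (u ++ [(i, f - algebraMap ℂ A (τ f))]) (by simp) (hua.append
    (IsAltWord.nil.cons (sub_mem hf (Subalgebra.algebraMap_mem _ _))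
      (by simp [Algebra.algebraMap_eq_smul_one, hτ]) (by simp)) (by simpa using hne))
  have h2 := hfree u hu hua
  simpa [mul_sub, h2, Algebra.algebraMap_eq_smul_one] using h1

/-- In a free family, an element times a nonempty word with a different first label is centered. -/
theorem map_mul_wordProd_eq_zero {ι : Type*} {L : ι → Subalgebra ℂ A} (hτ : τ 1 = 1)
    (hfree : ∀ l, l ≠ [] → IsAltWord L τ l → τ (wordProd l) = 0)
    {u : List (ι × A)} (hu : u ≠ []) (hua : IsAltWord L τ u) {i : ι}
    (hne : ∀ p ∈ u.head?, i ≠ p.1) {f : A} (hf : f ∈ L i) : τ (f * wordProd u) = 0 := by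
  have h1 := hfree ((i, f - algebraMap ℂ A (τ f)) :: u) (by simp) (hua.cons
    (sub_mem hf (Subalgebra.algebraMap_mem _ _))
      (by simp [Algebra.algebraMap_eq_smul_one, hτ]) hne)
  have h2 := hfree u hu hua
  simpa [sub_mul, h2, Algebra.algebraMap_eq_smul_one] using h1

/-- The functional `tri f t ↦ τ f`. -/
noncomputable def triTrace (τ : A →ₗ[ℂ] ℂ) : Matrix (Fin 2) (Fin 2) (A ⊗[ℂ] A) →ₗ[ℂ] ℂ :=
  τ ∘ₗ triBase τ

/-- The word underlying a word of matrices. -/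
noncomputable def baseWord (τ : A →ₗ[ℂ] ℂ)
    (l : List (Bool × Matrix (Fin 2) (Fin 2) (A ⊗[ℂ] A))) : List (Bool × A) :=
  l.map fun p => (p.1, triBase τ p.2)

theorem exists_of_mem_triLetters (hτ : τ 1 = 1) {b : Bool}
    {r : Matrix (Fin 2) (Fin 2) (A ⊗[ℂ] A)}
    (hr : r ∈ triLetters y x b) : r = tri (triBase τ r) (r 0 1) ∧
      triBase τ r ∈ pairAlg y x b ∧
      r 0 1 ∈ Submodule.span ℂ {s | ∃ g ∈ pairAlg y x b, ∃ h ∈ pairAlg y x b, g ⊗ₜ[ℂ] h = s} := by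
  cases b with
  | true =>
    obtain ⟨f, t, rfl, hf, ht, -⟩ := exists_of_mem_triLetters_true (τ := τ) hr
    rw [triBase_tri τ hτ]
    exact ⟨rfl, hf, ht⟩
  | false =>
    obtain ⟨f, rfl, hf⟩ := exists_of_mem_triLetters_false hr
    rw [triBase_tri τ hτ]
    exact ⟨rfl, hf, zero_mem _⟩

theorem IsAltWord.baseWord (hτ : τ 1 = 1) {l : List (Bool × Matrix (Fin 2) (Fin 2) (A ⊗[ℂ] A))}
    (hl : IsAltWord (triLetters y x) (triTrace τ) l) :
    IsAltWord (pairAlg y x) τ (baseWord τ l) := by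
  refine ⟨(List.isChain_map _).mpr hl.1, fun p hp => ?_⟩
  obtain ⟨q, hq, rfl⟩ := List.mem_map.mp hp
  exact ⟨(exists_of_mem_triLetters hτ (hl.2 q hq).1).2.1, (hl.2 q hq).2⟩

theorem wordProd_eq_tri (hτ : τ 1 = 1) {l : List (Bool × Matrix (Fin 2) (Fin 2) (A ⊗[ℂ] A))}
    (hl : IsAltWord (triLetters y x) (triTrace τ) l) :
    wordProd l = tri (wordProd (baseWord τ l)) (wordProd l 0 1) := by
  induction l with
  | nil => simp [← tri_one, baseWord, tri]
  | cons p l ih =>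
    rw [wordProd_cons, (exists_of_mem_triLetters hτ (hl.2 p List.mem_cons_self).1).1, ih hl.tail,
      tri_mul]
    simp [baseWord, tri]

theorem wordProd_cons_apply (hτ : τ 1 = 1) {p : Bool × Matrix (Fin 2) (Fin 2) (A ⊗[ℂ] A)}
    {l : List (Bool × Matrix (Fin 2) (Fin 2) (A ⊗[ℂ] A))}
    (hl : IsAltWord (triLetters y x) (triTrace τ) (p :: l)) :
    wordProd (p :: l) 0 1 =
      (triBase τ p.2 ⊗ₜ 1) * wordProd l 0 1 + p.2 0 1 * (1 ⊗ₜ wordProd (baseWord τ l)) := by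
  have h1 := (exists_of_mem_triLetters hτ (hl.2 p List.mem_cons_self).1).1
  have h2 := wordProd_eq_tri hτ hl.tail
  rw [wordProd_cons]
  nth_rewrite 1 [h1]
  nth_rewrite 1 [h2]
  rw [tri_mul]
  rfl

/-- The derivative of a word is killed by `τ ⊗ τ` after multiplication by a nonempty prefix. -/
theorem tensorSq_prefix_mul_eq_zero (hτ : τ 1 = 1)
    (hfree : ∀ l, l ≠ [] → IsAltWord (pairAlg y x) τ l → τ (wordProd l) = 0)
    (l : List (Bool × Matrix (Fin 2) (Fin 2) (A ⊗[ℂ] A)))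
    (hl : IsAltWord (triLetters y x) (triTrace τ) l) (u : List (Bool × A)) (hu : u ≠ [])
    (hul : IsAltWord (pairAlg y x) τ (u ++ baseWord τ l)) :
    tensorSq τ ((wordProd u ⊗ₜ 1) * wordProd l 0 1) = 0 := by
  induction l generalizing u with
  | nil => simp
  | cons p l ih =>
    rw [wordProd_cons_apply hτ hl, mul_add, map_add, ← mul_assoc,
      Algebra.TensorProduct.tmul_mul_tmul, mul_one]
    have h1 := ih hl.tail (u ++ [(p.1, triBase τ p.2)]) (by simp) (by simpa [baseWord] using hul)
    rw [show wordProd u * triBase τ p.2 = wordProd (u ++ [(p.1, triBase τ p.2)]) by simp, h1,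
      zero_add]
    have h2 := (exists_of_mem_triLetters hτ (hl.2 p List.mem_cons_self).1).2.2
    generalize p.2 0 1 = t at h2
    induction h2 using Submodule.span_induction with
    | zero => simp
    | add s t _ _ hs ht => rw [add_mul, mul_add, map_add, hs, ht, add_zero]
    | smul c t _ ht => rw [smul_mul_assoc, mul_smul_comm, map_smul, ht, smul_zero]
    | mem t ht =>
      obtain ⟨g, hg, h, hh, rfl⟩ := ht
      have h3 : τ (wordProd u * g) = 0 := by
        refine map_wordProd_mul_eq_zero hτ hfree hu hul.left_of_append (fun q hq => ?_) hg
        exact (List.isChain_append.mp hul.1).2.2 q hq (p.1, triBase τ p.2) (by simp [baseWord])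
      simp [h3]

/-- The derivative of a word of length at least two is killed by `τ ⊗ τ`. -/
theorem tensorSq_wordProd_eq_zero (hτ : τ 1 = 1)
    (hfree : ∀ l, l ≠ [] → IsAltWord (pairAlg y x) τ l → τ (wordProd l) = 0)
    {p : Bool × Matrix (Fin 2) (Fin 2) (A ⊗[ℂ] A)}
    {l : List (Bool × Matrix (Fin 2) (Fin 2) (A ⊗[ℂ] A))} (hne : l ≠ [])
    (hl : IsAltWord (triLetters y x) (triTrace τ) (p :: l)) :
    tensorSq τ (wordProd (p :: l) 0 1) = 0 := by
  have hb := hl.baseWord hτ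
  rw [wordProd_cons_apply hτ hl, map_add]
  have h1 := tensorSq_prefix_mul_eq_zero hτ hfree l hl.tail [(p.1, triBase τ p.2)] (by simp)
    (by simpa [baseWord] using hb)
  rw [show triBase τ p.2 = wordProd [(p.1, triBase τ p.2)] by simp, h1, zero_add]
  have h2 := (exists_of_mem_triLetters hτ (hl.2 p List.mem_cons_self).1).2.2
  generalize p.2 0 1 = t at h2
  induction h2 using Submodule.span_induction with
  | zero => simp
  | add s t _ _ hs ht => rw [add_mul, map_add, hs, ht, add_zero]
  | smul c t _ ht => rw [smul_mul_assoc, map_smul, ht, smul_zero]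
  | mem t ht =>
    obtain ⟨g, hg, h, hh, rfl⟩ := ht
    have h3 : τ (h * wordProd (baseWord τ l)) = 0 :=
      map_mul_wordProd_eq_zero hτ hfree (by simpa [baseWord] using hne) (hl.tail.baseWord hτ)
        (List.isChain_cons.mp hb.1).1 hh
    simp [h3]

/-- Let `φ` be a functional that satisfies the conjugate relation on powers of `y`. If `x` and `y`
are free and `φ` vanishes on centered polynomials in `x` and on all longer alternating centered
words, then `φ` satisfies the conjugate relation on powers of `y + x`: both `φ` and `(τ ⊗ τ) ∘ ∂`,
where `∂` is the partial free difference quotient with respect to `y`, vanish on the words that are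
not polynomials in `y`. -/
theorem conjugate_relation_add (hτ : τ 1 = 1)
    (hfree : ∀ l, l ≠ [] → IsAltWord (pairAlg y x) τ l → τ (wordProd l) = 0) (φ : A →ₗ[ℂ] ℂ)
    (hφ : ∀ k : ℕ, φ (y ^ k) = ∑ i ∈ Finset.range k, τ (y ^ i) * τ (y ^ (k - 1 - i)))
    (hφx : ∀ f ∈ Algebra.adjoin ℂ {x}, τ f = 0 → φ f = 0)
    (hφw : ∀ p l, l ≠ [] → IsAltWord (pairAlg y x) τ (p :: l) → φ (wordProd (p :: l)) = 0)
    (k : ℕ) : φ ((y + x) ^ k) =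
      ∑ i ∈ Finset.range k, τ ((y + x) ^ i) * τ ((y + x) ^ (k - 1 - i)) := by
  have key : ∀ r ∈ altSpan (triLetters y x) (triTrace τ) Set.univ,
      φ (triBase τ r) = tensorSq τ (r 0 1) := by
    intro r hr
    induction hr using Submodule.span_induction with
    | zero => simp
    | add r s _ _ hr hs => simp [hr, hs]
    | smul c r _ hr => simp [hr]
    | mem r hr =>
      obtain ⟨l, hl, -, rfl⟩ := hr
      match l, hl with
      | [], _ =>
        have h1 : φ 1 = 0 := by simpa using hφ 0
        rw [wordProd_nil, ← tri_one, triBase_tri τ hτ, h1]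
        simp [tri]
      | [(true, r)], hl =>
        obtain ⟨f, t, h, -, -, ht⟩ := exists_of_mem_triLetters_true (τ := τ)
          (hl.2 _ List.mem_cons_self).1
        dsimp only at h
        simp only [wordProd_cons, wordProd_nil, mul_one]
        rw [h, triBase_tri τ hτ, ht φ hφ]
        rfl
      | [(false, r)], hl =>
        have h0 : triTrace τ r = 0 := (hl.2 _ List.mem_cons_self).2
        obtain ⟨f, h, hf⟩ := exists_of_mem_triLetters_false (hl.2 _ List.mem_cons_self).1
        dsimp only at h
        simp only [wordProd_cons, wordProd_nil, mul_one]
        rw [h, triTrace, LinearMap.comp_apply, triBase_tri τ hτ] at h0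
        rw [h, triBase_tri τ hτ, hφx f hf h0]
        simp [tri]
      | p :: q :: l, hl =>
        rw [tensorSq_wordProd_eq_zero hτ hfree (by simp) hl, wordProd_eq_tri hτ hl,
          triBase_tri τ hτ]
        exact hφw _ _ (by simp) (hl.baseWord hτ)
  have hmem : tri (y + x) (1 ⊗ₜ 1) ^ k ∈ altSpan (triLetters y x) (triTrace τ) Set.univ := by
    refine groupAlg_le_altSpan ?_ (pow_mem ?_ k)
    · rw [← tri_one, triTrace, LinearMap.comp_apply, triBase_tri τ hτ, hτ]
    · rw [← add_zero ((1 : A) ⊗ₜ[ℂ] (1 : A)), ← tri_add]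
      exact add_mem
        (mem_groupAlg (Set.mem_univ true) (Algebra.self_mem_adjoin_singleton ℂ (tri y (1 ⊗ₜ 1))))
        (mem_groupAlg (Set.mem_univ false) (Algebra.self_mem_adjoin_singleton ℂ (tri x 0)))
  have := key _ hmem
  rw [tri_pow, triBase_tri τ hτ] at this
  rw [this]
  simp [tri]

end FreeSum

/-! ### Freeness in `L²` -/

namespace TracialState

variable {A : Type*} [Ring A] [StarRing A] [Algebra ℂ A] [StarModule ℂ A] {τ : TracialState A}

theorem map_mul_comm (τ : TracialState A) (a b : A) : τ (a * b) = τ (b * a) := τ.mul_comm' a b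

theorem map_one (τ : TracialState A) : τ (1 : A) = 1 := τ.map_one'

theorem FreeSubalgebras.map_wordProd {ι : Type*} {B : ι → StarSubalgebra ℂ A}
    (h : τ.FreeSubalgebras B) (l : List (ι × A)) (hl : l ≠ [])
    (ha : IsAltWord (fun i => (B i).toSubalgebra) τ.toLinearMap l) : τ (wordProd l) = 0 :=
  h l hl ha.1 ha.2

section Words

variable {ι : Type*} {B : ι → StarSubalgebra ℂ A}

theorem isAltWord_star_reverse {l : List (ι × A)}
    (h : IsAltWord (fun i => (B i).toSubalgebra) τ.toLinearMap l) :
    IsAltWord (fun i => (B i).toSubalgebra) τ.toLinearMap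
      (l.map fun p => (p.1, star p.2)).reverse := by
  refine ⟨?_, fun p hp => ?_⟩
  · rw [List.isChain_reverse, List.isChain_map]
    exact h.1.imp fun _ _ h => h.symm
  · obtain ⟨q, hq, rfl⟩ := List.mem_map.mp (List.mem_reverse.mp hp)
    refine ⟨star_mem (s := B q.1) (h.2 q hq).1, ?_⟩
    rw [τ.map_star, (h.2 q hq).2, _root_.map_zero]

theorem map_star_wordProd_mul_eq_zero_of_head (hfree : τ.FreeSubalgebras B) {l m : List (ι × A)}
    (hl : IsAltWord (fun i => (B i).toSubalgebra) τ.toLinearMap l)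
    (hm : IsAltWord (fun i => (B i).toSubalgebra) τ.toLinearMap m) (hne : m ≠ [])
    (hlm : ∀ p ∈ l.head?, ∀ q ∈ m.head?, p.1 ≠ q.1) :
    τ (star (wordProd l) * wordProd m) = 0 := by
  rw [star_wordProd, ← wordProd_append]
  refine hfree.map_wordProd _ (by simp [hne]) ((isAltWord_star_reverse hl).append hm ?_)
  intro p hp q hq
  rw [List.getLast?_reverse, List.head?_map] at hp
  obtain ⟨p', hp', rfl⟩ := Option.mem_map.mp hp
  exact hlm p' hp' q hq

/-- Alternating centered words with different label sequences are orthogonal. -/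
theorem map_star_wordProd_mul_eq_zero (hfree : τ.FreeSubalgebras B) {l m : List (ι × A)}
    (hl : IsAltWord (fun i => (B i).toSubalgebra) τ.toLinearMap l)
    (hm : IsAltWord (fun i => (B i).toSubalgebra) τ.toLinearMap m)
    (hlm : l.map Prod.fst ≠ m.map Prod.fst) : τ (star (wordProd l) * wordProd m) = 0 := by
  induction l generalizing m with
  | nil =>
    refine map_star_wordProd_mul_eq_zero_of_head hfree hl hm ?_ (by simp)
    rintro rfl
    exact hlm rfl
  | cons p l ih =>
    cases m with
    | nil =>
      have h := map_star_wordProd_mul_eq_zero_of_head hfree hm hl (by simp) (by simp)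
      rw [wordProd_nil, star_one, one_mul] at h
      rw [wordProd_nil, mul_one, τ.map_star, h, _root_.map_zero]
    | cons q m =>
      by_cases hpq : p.1 = q.1
      · obtain ⟨i, e⟩ := p
        obtain ⟨i', f⟩ := q
        dsimp only at hpq
        subst hpq
        -- Only the mean of the product of the first letters contributes.
        have hc := map_star_wordProd_mul_eq_zero_of_head hfree hl.tail
          (m := (i, star e * f - algebraMap ℂ A (τ (star e * f))) :: m) (hm.tail.cons
            (sub_mem (mul_mem (star_mem (s := B i) (hl.2 _ List.mem_cons_self).1)
              (hm.2 _ List.mem_cons_self).1) (Subalgebra.algebraMap_mem _ _))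
            (by simp [Algebra.algebraMap_eq_smul_one, τ.map_one])
            (List.isChain_cons.mp hm.1).1) (by simp)
          (by
            intro a ha b hb
            simp only [List.head?_cons, Option.mem_def, Option.some.injEq] at hb
            subst hb
            exact ((List.isChain_cons.mp hl.1).1 a ha).symm)
        have ht := ih hl.tail hm.tail (by simpa using hlm)
        have e1 : star (wordProd ((i, e) :: l)) * wordProd ((i, f) :: m) =
            star (wordProd l) * wordProd
              ((i, star e * f - algebraMap ℂ A (τ (star e * f))) :: m) +
            τ (star e * f) • (star (wordProd l) * wordProd m) := by
          simp [sub_mul, mul_sub, Algebra.algebraMap_eq_smul_one, mul_assoc]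
        rw [e1, map_add, map_smul, hc, ht, smul_zero, add_zero]
      · exact map_star_wordProd_mul_eq_zero_of_head hfree hl hm (by simp) (by simpa using hpq)

end Words

/-- The closure in `L²(A, τ)` of a subspace of `A`. -/
noncomputable def closureL2 (τ : TracialState A) (S : Submodule ℂ A) : Submodule ℂ τ.L2 :=
  (S.map τ.toL2).topologicalClosure

theorem toL2_mem_closureL2 {S : Submodule ℂ A} {p : A} (hp : p ∈ S) :
    τ.toL2 p ∈ τ.closureL2 S :=
  Submodule.le_topologicalClosure _ (Submodule.mem_map_of_mem hp)

theorem closureL2_mono {S T : Submodule ℂ A} (h : S ≤ T) : τ.closureL2 S ≤ τ.closureL2 T :=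
  Submodule.topologicalClosure_mono (Submodule.map_mono h)

theorem closureL2_le {S : Submodule ℂ A} {K : Submodule ℂ τ.L2} (hK : IsClosed (K : Set τ.L2))
    (h : ∀ p ∈ S, τ.toL2 p ∈ K) : τ.closureL2 S ≤ K := by
  refine Submodule.topologicalClosure_minimal _ ?_ hK
  rintro _ ⟨p, hp, rfl⟩
  exact h p hp

instance (S : Submodule ℂ A) : CompleteSpace (τ.closureL2 S) :=
  (Submodule.isClosed_topologicalClosure _).completeSpace_coe

theorem inner_eq_zero_of_mem_closureL2 {S : Submodule ℂ A} {v ξ : τ.L2}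
    (h : ∀ q ∈ S, inner ℂ (τ.toL2 q) v = 0) (hξ : ξ ∈ τ.closureL2 S) : inner ℂ ξ v = 0 := by
  have := closureL2_le (τ := τ) (S := S) (K := (ℂ ∙ v)ᗮ) (Submodule.isClosed_orthogonal _)
    (fun q hq => Submodule.mem_orthogonal_singleton_iff_inner_left.mpr (h q hq)) hξ
  exact Submodule.mem_orthogonal_singleton_iff_inner_left.mp this

theorem inner_eq_zero_of_mem_closureL2_span {s : Set A} {v ξ : τ.L2}
    (h : ∀ p ∈ s, inner ℂ (τ.toL2 p) v = 0) (hξ : ξ ∈ τ.closureL2 (Submodule.span ℂ s)) :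
    inner ℂ ξ v = 0 := by
  refine inner_eq_zero_of_mem_closureL2 (fun q hq => ?_) hξ
  induction hq using Submodule.span_induction with
  | zero => simp
  | add p q _ _ hp hq => rw [map_add, inner_add_left, hp, hq, add_zero]
  | smul c p _ hp => rw [map_smul, inner_smul_left, hp, mul_zero]
  | mem p hp => exact h p hp

/-- A vector in the closure of `S` that is orthogonal to `S` vanishes. -/
theorem eq_zero_of_mem_closureL2 {S : Submodule ℂ A} {ξ : τ.L2} (hξ : ξ ∈ τ.closureL2 S)
    (h : ∀ q ∈ S, inner ℂ ξ (τ.toL2 q) = 0) : ξ = 0 := by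
  rw [← inner_self_eq_zero (𝕜 := ℂ)]
  exact inner_eq_zero_of_mem_closureL2 (fun q hq => inner_eq_zero_symm.mp (h q hq)) hξ

/-- The relation `⟨ξ, yᵏ⟩ = ⟨1 ⊗ 1, ∂_y (yᵏ)⟩`, `k ≥ 0`, for a vector `ξ` of `L²(A, τ)`. -/
def ConjRel (τ : TracialState A) (y : A) (ξ : τ.L2) : Prop :=
  ∀ k : ℕ, inner ℂ ξ (τ.toL2 (y ^ k)) =
    ∑ i ∈ Finset.range k, τ (y ^ i) * τ (y ^ (k - 1 - i))

/-- The space `L²` of the polynomials in `y`. -/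
noncomputable def polyL2 (τ : TracialState A) (y : A) : Submodule ℂ τ.L2 :=
  τ.closureL2 (Subalgebra.toSubmodule (Algebra.adjoin ℂ {y}))

theorem star_mem_adjoin {y : A} (hy : IsSelfAdjoint y) {q : A} (hq : q ∈ Algebra.adjoin ℂ {y}) :
    star q ∈ Algebra.adjoin ℂ {y} := by
  refine adjoin_singleton_induction (P := fun q => star q ∈ Algebra.adjoin ℂ {y}) ?_ ?_ ?_ hq
  · intro a b ha hb; rw [star_add]; exact add_mem ha hb
  · intro c a ha; rw [star_smul]; exact Subalgebra.smul_mem _ ha _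
  · intro k
    rw [star_pow, hy.star_eq]
    exact pow_mem (Algebra.self_mem_adjoin_singleton ℂ y) k

/-- If `x` and `y` are free, then the conjugate relation for `y` implies the one for `y + x`. -/
theorem ConjRel.add {y x : A} (hy : IsSelfAdjoint y)
    (hfree : ∀ l, l ≠ [] → IsAltWord (pairAlg y x) τ.toLinearMap l → τ (wordProd l) = 0)
    {ξ : τ.L2} (hξ : ξ ∈ τ.polyL2 y) (h : τ.ConjRel y ξ) : τ.ConjRel (y + x) ξ := by
  refine conjugate_relation_add τ.map_one hfree ((innerSL ℂ ξ).toLinearMap ∘ₗ τ.toL2) h ?_ ?_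
  · intro f hf h0
    refine inner_eq_zero_of_mem_closureL2 (fun q hq => ?_) hξ
    rw [inner_toL2]
    have := map_mul_wordProd_eq_zero (u := [(false, f)]) (i := true) τ.map_one hfree (by simp)
      (IsAltWord.nil.cons hf h0 (by simp)) (by simp) (star_mem_adjoin hy hq)
    simpa using this
  · intro p l hl hw
    refine inner_eq_zero_of_mem_closureL2 (fun q hq => ?_) hξ
    rw [inner_toL2]
    have hq' : star q ∈ pairAlg y x true := star_mem_adjoin hy hq
    by_cases hp : p.1 = true
    · rw [wordProd_cons, ← mul_assoc]
      have hp2 := (hw.2 p List.mem_cons_self).1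
      have hne := (List.isChain_cons.mp hw.1).1
      rw [hp] at hp2
      simp only [hp] at hne
      exact map_mul_wordProd_eq_zero τ.map_one hfree hl hw.tail hne (mul_mem hq' hp2)
    · exact map_mul_wordProd_eq_zero (i := true) τ.map_one hfree (by simp) hw
        (by
          intro q' hq''
          simp only [List.head?_cons, Option.mem_def, Option.some.injEq] at hq''
          subst hq''
          exact fun h => hp h.symm) hq'

end TracialState

/-! ### Semicircular moments -/

/-- The integral of `tᵏ √(R² - t²)` over `[-R, R]`. -/
noncomputable def semicircleIntegral (R : ℝ) (k : ℕ) : ℝ :=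
  ∫ t in (-R)..R, t ^ k * √(R ^ 2 - t ^ 2)

theorem semicircleIntegral_zero {R : ℝ} (hR : 0 < R) :
    semicircleIntegral R 0 = Real.pi * R ^ 2 / 2 := by
  have h := intervalIntegral.mul_integral_comp_mul_left (a := -1) (b := 1)
    (f := fun t : ℝ => √(R ^ 2 - t ^ 2)) R
  have e : ∀ t : ℝ, √(R ^ 2 - (R * t) ^ 2) = R * √(1 - t ^ 2) := by
    intro t
    rw [show R ^ 2 - (R * t) ^ 2 = R ^ 2 * (1 - t ^ 2) by ring, Real.sqrt_mul (sq_nonneg R),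
      Real.sqrt_sq hR.le]
  simp only [e, intervalIntegral.integral_const_mul, integral_sqrt_one_sub_sq, mul_neg,
    mul_one] at h
  simp only [semicircleIntegral, pow_zero, one_mul, ← h]
  ring

theorem semicircleIntegral_odd (R : ℝ) (k : ℕ) : semicircleIntegral R (2 * k + 1) = 0 := by
  have h := intervalIntegral.integral_comp_neg (a := -R) (b := R)
    (fun t : ℝ => t ^ (2 * k + 1) * √(R ^ 2 - t ^ 2))
  simp only [neg_neg, Odd.neg_pow (⟨k, rfl⟩ : Odd (2 * k + 1)), neg_mul, neg_sq,
    intervalIntegral.integral_neg] at h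
  simp only [semicircleIntegral]
  linarith

/-- Integration by parts against `(R² - t²) √(R² - t²)`. -/
theorem semicircleIntegral_add_two {R : ℝ} (hR : 0 < R) (k : ℕ) :
    (k + 4) * semicircleIntegral R (k + 2) = (k + 1) * R ^ 2 * semicircleIntegral R k := by
  have hint : ∀ m : ℕ, IntervalIntegrable (fun t : ℝ => t ^ m * √(R ^ 2 - t ^ 2))
      MeasureTheory.volume (-R) R := fun m => by
    apply Continuous.intervalIntegrable; fun_prop
  have hd : ∀ t ∈ Set.Ioo (-R) R, HasDerivAt
      (fun t : ℝ => t ^ (k + 1) * ((R ^ 2 - t ^ 2) * √(R ^ 2 - t ^ 2)))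
      ((k + 1) * R ^ 2 * (t ^ k * √(R ^ 2 - t ^ 2))
        - (k + 4) * (t ^ (k + 2) * √(R ^ 2 - t ^ 2))) t := by
    intro t ht
    have hpos : 0 < R ^ 2 - t ^ 2 := by nlinarith [ht.1, ht.2]
    have h1 : HasDerivAt (fun t : ℝ => R ^ 2 - t ^ 2) (-(2 * t)) t := by
      simpa using (hasDerivAt_pow 2 t).const_sub (R ^ 2)
    have h2 : HasDerivAt (fun t : ℝ => t ^ (k + 1) * ((R ^ 2 - t ^ 2) * √(R ^ 2 - t ^ 2)))
        (↑(k + 1) * t ^ (k + 1 - 1) * ((R ^ 2 - t ^ 2) * √(R ^ 2 - t ^ 2)) +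
          t ^ (k + 1) * (-(2 * t) * √(R ^ 2 - t ^ 2) +
            (R ^ 2 - t ^ 2) * (-(2 * t) / (2 * √(R ^ 2 - t ^ 2))))) t :=
      (hasDerivAt_pow (k + 1) t).mul (h1.mul (h1.sqrt hpos.ne'))
    refine h2.congr_deriv ?_
    have hs : √(R ^ 2 - t ^ 2) ≠ 0 := (Real.sqrt_pos.mpr hpos).ne'
    have hs2 : R ^ 2 - t ^ 2 = √(R ^ 2 - t ^ 2) ^ 2 := (Real.sq_sqrt hpos.le).symm
    have h3 : (R ^ 2 - t ^ 2) * (-(2 * t) / (2 * √(R ^ 2 - t ^ 2))) = -t * √(R ^ 2 - t ^ 2) := by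
      field_simp
      linear_combination (-t) * hs2
    rw [h3, add_tsub_cancel_right]
    push_cast
    ring
  have h := intervalIntegral.integral_eq_sub_of_hasDerivAt_of_le (by linarith : -R ≤ R)
    (by fun_prop) hd (((hint k).const_mul _).sub ((hint (k + 2)).const_mul _))
  rw [intervalIntegral.integral_sub ((hint k).const_mul _) ((hint (k + 2)).const_mul _),
    intervalIntegral.integral_const_mul, intervalIntegral.integral_const_mul] at h
  simp only [semicircleIntegral]
  simp at h
  linarith

/-- The even moments of the semicircle law are Catalan numbers. -/
theorem semicircleIntegral_even {γ : ℝ} (hγ : 0 < γ) (k : ℕ) :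
    semicircleIntegral (2 * √γ) (2 * k) = 2 * Real.pi * γ * (γ ^ k * catalan k) := by
  have hR : 0 < 2 * √γ := by positivity
  have hR2 : (2 * √γ) ^ 2 = 4 * γ := by rw [mul_pow, Real.sq_sqrt hγ.le]; norm_num
  induction k with
  | zero => rw [mul_zero, semicircleIntegral_zero hR, hR2]; simp; ring
  | succ k ih =>
    have h := semicircleIntegral_add_two hR (2 * k)
    rw [ih, hR2] at h
    have h1 : ((k : ℝ) + 2) * catalan (k + 1) = 2 * (2 * k + 1) * catalan k := by
      have h2 := succ_mul_catalan_eq_centralBinom (k + 1)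
      have h3 := succ_mul_catalan_eq_centralBinom k
      have h4 := Nat.succ_mul_centralBinom_succ k
      rw [← h2, ← h3] at h4
      have h5 : (k + 1 + 1) * catalan (k + 1) = 2 * (2 * k + 1) * catalan k :=
        Nat.eq_of_mul_eq_mul_left (by positivity : 0 < k + 1) (by rw [h4]; ring)
      have h6 := congrArg (Nat.cast : ℕ → ℝ) h5
      push_cast at h6
      linarith
    have h7 : (0 : ℝ) < 2 * k + 4 := by positivity
    refine mul_left_cancel₀ h7.ne' ?_
    rw [show 2 * (k + 1) = 2 * k + 2 by ring]
    push_cast at h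
    rw [h, pow_succ]
    linear_combination (-4 * Real.pi * γ * γ * γ ^ k) * h1

/-- The density of the semicircle law with mean `0`, written as in `semicircleLaw`. -/
noncomputable def semicircleDensity (γ : ℝ) : ℝ → ℝ :=
  (Set.Icc (0 - 2 * √γ) (0 + 2 * √γ)).indicator
    (fun t => 1 / (2 * Real.pi * γ) * √(4 * γ - (t - 0) ^ 2))

theorem semicircleDensity_nonneg {γ : ℝ} (hγ : 0 < γ) (t : ℝ) : 0 ≤ semicircleDensity γ t :=
  Set.indicator_nonneg (fun t _ => by positivity) t

theorem measurable_semicircleDensity (γ : ℝ) : Measurable (semicircleDensity γ) :=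
  Measurable.indicator (by fun_prop) measurableSet_Icc

theorem semicircleLaw_zero_eq (γ : ℝ) : semicircleLaw 0 γ =
    MeasureTheory.volume.withDensity fun t => ENNReal.ofReal (semicircleDensity γ t) := rfl

theorem integral_mul_semicircleDensity {γ : ℝ} (hγ : 0 < γ) (k : ℕ) :
    ∫ t, semicircleDensity γ t * t ^ k =
      1 / (2 * Real.pi * γ) * semicircleIntegral (2 * √γ) k := by
  have hR : -(2 * √γ) ≤ 2 * √γ := by have := Real.sqrt_nonneg γ; linarith
  have hR2 : (2 * √γ) ^ 2 = 4 * γ := by rw [mul_pow, Real.sq_sqrt hγ.le]; norm_num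
  rw [semicircleIntegral, intervalIntegral.integral_of_le hR,
    ← MeasureTheory.integral_Icc_eq_integral_Ioc, ← MeasureTheory.integral_const_mul,
    ← MeasureTheory.integral_indicator measurableSet_Icc]
  refine MeasureTheory.integral_congr_ae (Filter.Eventually.of_forall fun t => ?_)
  simp only [semicircleDensity, zero_sub, zero_add, sub_zero, Set.indicator_apply, hR2]
  split_ifs
  · ring
  · simp

theorem integrable_semicircleDensity (γ : ℝ) :
    MeasureTheory.Integrable (semicircleDensity γ) := by
  rw [semicircleDensity, MeasureTheory.integrable_indicator_iff measurableSet_Icc]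
  exact Continuous.integrableOn_Icc (by fun_prop)

theorem integral_pow_semicircleLaw {γ : ℝ} (hγ : 0 < γ) (k : ℕ) :
    ∫ t, t ^ k ∂(semicircleLaw 0 γ) = 1 / (2 * Real.pi * γ) * semicircleIntegral (2 * √γ) k := by
  rw [semicircleLaw_zero_eq, integral_withDensity_eq_integral_toReal_smul
    (measurable_semicircleDensity γ).ennreal_ofReal (by simp), ← integral_mul_semicircleDensity hγ]
  simp [ENNReal.toReal_ofReal (semicircleDensity_nonneg hγ _)]

theorem isProbabilityMeasure_semicircleLaw {γ : ℝ} (hγ : 0 < γ) :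
    MeasureTheory.IsProbabilityMeasure (semicircleLaw 0 γ) := by
  refine ⟨?_⟩
  rw [semicircleLaw_zero_eq, MeasureTheory.withDensity_apply _ MeasurableSet.univ,
    MeasureTheory.Measure.restrict_univ,
    ← MeasureTheory.ofReal_integral_eq_lintegral_ofReal (integrable_semicircleDensity γ)
      (Filter.Eventually.of_forall (semicircleDensity_nonneg hγ))]
  have h := integral_mul_semicircleDensity hγ 0
  have h0 := semicircleIntegral_even hγ 0
  simp only [mul_zero] at h0
  rw [h0] at h
  simp only [pow_zero, mul_one, catalan_zero, Nat.cast_one] at h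
  rw [h, one_div, inv_mul_cancel₀ (by positivity), ENNReal.ofReal_one]

theorem semicircleLaw_compl_Icc (γ : ℝ) :
    semicircleLaw 0 γ (Set.Icc (-(2 * √γ)) (2 * √γ))ᶜ = 0 := by
  rw [semicircleLaw_zero_eq, MeasureTheory.withDensity_apply _ measurableSet_Icc.compl]
  rw [MeasureTheory.setLIntegral_congr_fun (g := fun _ => 0) measurableSet_Icc.compl]
  · simp
  · intro t ht
    simp only [semicircleDensity, zero_sub, zero_add, Set.indicator_of_notMem ht,
      ENNReal.ofReal_zero]

theorem sum_range_two_mul_add_one {M : Type*} [AddCommMonoid M] (f : ℕ → M) (n : ℕ) :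
    ∑ i ∈ Finset.range (2 * n + 1), f i =
      ∑ a ∈ Finset.range (n + 1), f (2 * a) + ∑ a ∈ Finset.range n, f (2 * a + 1) := by
  induction n with
  | zero => simp
  | succ n ih =>
    rw [show 2 * (n + 1) + 1 = 2 * n + 1 + 1 + 1 by ring, Finset.sum_range_succ,
      Finset.sum_range_succ, ih, Finset.sum_range_succ (fun a => f (2 * a)) (n + 1),
      Finset.sum_range_succ (fun a => f (2 * a + 1)) n, show 2 * (n + 1) = 2 * n + 1 + 1 by ring]
    abel

/-- A sequence with `m₀ = 1` and `m_{k+1} = γ ∑_{i<k} mᵢ m_{k-1-i}` for `k ≥ 0` is the moment sequence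
of the semicircle law: both are given by Catalan numbers. -/
theorem integral_pow_semicircleLaw_eq {γ : ℝ} (hγ : 0 < γ) {m : ℕ → ℂ} (h0 : m 0 = 1)
    (h : ∀ k, m (k + 1) = γ * ∑ i ∈ Finset.range k, m i * m (k - 1 - i)) (k : ℕ) :
    ((∫ t, t ^ k ∂(semicircleLaw 0 γ) : ℝ) : ℂ) = m k := by
  have key : ∀ n, m (2 * n + 1) = 0 ∧ m (2 * n) = γ ^ n * catalan n := by
    intro n
    induction n using Nat.strong_induction_on with
    | _ n ih =>
    have heven : m (2 * n) = γ ^ n * catalan n := by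
      cases n with
      | zero => simp [h0]
      | succ n =>
        rw [show 2 * (n + 1) = (2 * n + 1) + 1 by ring, h, catalan_succ,
          show 2 * n + 1 - 1 = 2 * n by omega]
        have hodd : ∀ a ∈ Finset.range n, m (2 * a + 1) * m (2 * n - (2 * a + 1)) = 0 := by
          intro a ha
          have ha := Finset.mem_range.mp ha
          rw [(ih a (by omega)).1, zero_mul]
        rw [sum_range_two_mul_add_one, Finset.sum_eq_zero hodd, add_zero, pow_succ']
        push_cast
        rw [Finset.sum_range, mul_assoc]
        congr 1
        rw [Finset.mul_sum]
        refine Finset.sum_congr rfl fun a _ => ?_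
        have ha : (a : ℕ) < n + 1 := a.2
        have e : (γ : ℂ) ^ n = γ ^ (a : ℕ) * γ ^ (n - a) := by
          rw [← pow_add]
          congr 1
          omega
        rw [show 2 * n - 2 * (a : ℕ) = 2 * (n - a) by omega, (ih a ha).2,
          (ih (n - a) (by omega)).2, e]
        ring
    refine ⟨?_, heven⟩
    rw [h, Finset.sum_eq_zero, mul_zero]
    intro i hi
    have hi := Finset.mem_range.mp hi
    obtain ⟨a, rfl | rfl⟩ := Nat.even_or_odd' i
    · rw [show 2 * n - 1 - 2 * a = 2 * (n - 1 - a) + 1 by omega, (ih _ (by omega)).1, mul_zero]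
    · rw [(ih a (by omega)).1, zero_mul]
  rw [integral_pow_semicircleLaw hγ]
  obtain ⟨n, rfl | rfl⟩ := Nat.even_or_odd' k
  · rw [semicircleIntegral_even hγ, (key n).2]
    have : (Real.pi : ℂ) ≠ 0 := by exact_mod_cast Real.pi_ne_zero
    have : (γ : ℂ) ≠ 0 := by exact_mod_cast hγ.ne'
    push_cast
    field_simp
  · rw [semicircleIntegral_odd, (key n).1]
    simp

/-! ### The variance inequality for leave-one-out families -/

section Hilbert

variable {ι K : Type*} [Fintype ι] [NormedAddCommGroup K]

theorem norm_sq_sum_le_of_card (s : Finset ι) (u : ι → K) (hu : ∀ j ∉ s, u j = 0) :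
    ‖∑ j, u j‖ ^ 2 ≤ s.card * ∑ j, ‖u j‖ ^ 2 := by
  have e1 : ∑ j, u j = ∑ j ∈ s, u j :=
    (Finset.sum_subset (Finset.subset_univ s) fun j _ hj => hu j hj).symm
  have e2 : ∑ j, ‖u j‖ ^ 2 = ∑ j ∈ s, ‖u j‖ ^ 2 :=
    (Finset.sum_subset (Finset.subset_univ s) fun j _ hj => by simp [hu j hj]).symm
  rw [e1, e2]
  exact (pow_le_pow_left₀ (norm_nonneg _) (norm_sum_le _ _) 2).trans sq_sum_le_card_mul_sum_sq

variable [DecidableEq ι] [InnerProductSpace ℂ K]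

/-- If the `j`-th vector has no component in `N S` for `j ∈ S`, then the component of the sum in
`N S` has at most `card ι - card S` nonzero summands. If moreover there are no components in `N ∅`,
then the second sum on the left is nonnegative, and the constant `card ι` of the Cauchy–Schwarz
inequality improves to `card ι - 1`. -/
theorem norm_sq_sum_add_le {N : Finset ι → Submodule ℂ K}
    (hN : OrthogonalFamily ℂ (fun S => N S) fun S => (N S).subtypeₗᵢ) (c : ι → Finset ι → K)
    (hc : ∀ j S, c j S ∈ N S) (hmem : ∀ j S, j ∈ S → c j S = 0) :
    ‖∑ j, ∑ S, c j S‖ ^ 2 + ∑ S : Finset ι, ((S.card : ℝ) - 1) * ∑ j, ‖c j S‖ ^ 2 ≤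
      ((Fintype.card ι : ℝ) - 1) * ∑ j, ‖∑ S, c j S‖ ^ 2 := by
  have pyth : ∀ u : Finset ι → K, (∀ S, u S ∈ N S) → ‖∑ S, u S‖ ^ 2 = ∑ S, ‖u S‖ ^ 2 :=
    fun u hu => hN.norm_sum (fun S => ⟨u S, hu S⟩) Finset.univ
  have e1 : ∀ j, ‖∑ S, c j S‖ ^ 2 = ∑ S, ‖c j S‖ ^ 2 := fun j => pyth (c j) (hc j)
  have e2 : ‖∑ j, ∑ S, c j S‖ ^ 2 = ∑ S, ‖∑ j, c j S‖ ^ 2 := by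
    rw [Finset.sum_comm]
    exact pyth _ fun S => sum_mem fun j _ => hc j S
  simp only [e1, e2]
  rw [Finset.sum_comm (s := (Finset.univ : Finset ι)), Finset.mul_sum, ← Finset.sum_add_distrib]
  refine Finset.sum_le_sum fun S _ => ?_
  have h := norm_sq_sum_le_of_card Sᶜ (fun j => c j S) fun j hj => hmem j S (by simpa using hj)
  rw [Finset.card_compl, Nat.cast_sub (Finset.card_le_univ S)] at h
  linarith

end Hilbert

namespace TracialState

variable {A : Type*} [Ring A] [StarRing A] [Algebra ℂ A] [StarModule ℂ A] {τ : TracialState A}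
  {ι : Type*} {B : ι → StarSubalgebra ℂ A}

theorem inner_eq_zero_of_mem_altSpan {T : Set ι} {v ξ : τ.L2}
    (h : ∀ l, IsAltWord (fun i => (B i).toSubalgebra) τ.toLinearMap l → (∀ p ∈ l, p.1 ∈ T) →
      inner ℂ (τ.toL2 (wordProd l)) v = 0)
    (hξ : ξ ∈ τ.closureL2 (altSpan (fun i => (B i).toSubalgebra) τ.toLinearMap T)) :
    inner ℂ ξ v = 0 :=
  inner_eq_zero_of_mem_closureL2_span (by rintro _ ⟨l, hl, hT, rfl⟩; exact h l hl hT) hξ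

theorem inner_toL2_wordProd_eq_zero (hfree : τ.FreeSubalgebras B) {l m : List (ι × A)}
    (hl : IsAltWord (fun i => (B i).toSubalgebra) τ.toLinearMap l)
    (hm : IsAltWord (fun i => (B i).toSubalgebra) τ.toLinearMap m)
    (hlm : l.map Prod.fst ≠ m.map Prod.fst) :
    inner ℂ (τ.toL2 (wordProd l)) (τ.toL2 (wordProd m)) = 0 := by
  rw [inner_toL2, map_star_wordProd_mul_eq_zero hfree hl hm hlm]

variable [DecidableEq ι]

/-- The closed span in `L²(A, τ)` of the alternating centered words whose set of labels is `S`. -/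
noncomputable def supportL2 (τ : TracialState A) (B : ι → StarSubalgebra ℂ A) (S : Finset ι) :
    Submodule ℂ τ.L2 :=
  τ.closureL2 (Submodule.span ℂ {r | ∃ l,
    IsAltWord (fun i => (B i).toSubalgebra) τ.toLinearMap l ∧ (l.map Prod.fst).toFinset = S ∧
      wordProd l = r})

instance (S : Finset ι) : CompleteSpace (τ.supportL2 B S) := by
  unfold supportL2; infer_instance

theorem toL2_wordProd_mem_supportL2 {l : List (ι × A)}
    (hl : IsAltWord (fun i => (B i).toSubalgebra) τ.toLinearMap l) :
    τ.toL2 (wordProd l) ∈ τ.supportL2 B (l.map Prod.fst).toFinset :=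
  toL2_mem_closureL2 (Submodule.subset_span ⟨l, hl, rfl, rfl⟩)

theorem inner_eq_zero_of_mem_supportL2 {S : Finset ι} {v ξ : τ.L2}
    (h : ∀ l, IsAltWord (fun i => (B i).toSubalgebra) τ.toLinearMap l →
      (l.map Prod.fst).toFinset = S → inner ℂ (τ.toL2 (wordProd l)) v = 0)
    (hξ : ξ ∈ τ.supportL2 B S) : inner ℂ ξ v = 0 :=
  inner_eq_zero_of_mem_closureL2_span (by rintro _ ⟨l, hl, hS, rfl⟩; exact h l hl hS) hξ

theorem orthogonalFamily_supportL2 (hfree : τ.FreeSubalgebras B) :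
    OrthogonalFamily ℂ (fun S => τ.supportL2 B S) fun S => (τ.supportL2 B S).subtypeₗᵢ := by
  rintro S S' hS ⟨v, hv⟩ ⟨w, hw⟩
  refine inner_eq_zero_of_mem_supportL2 (fun l hl hlS => inner_eq_zero_symm.mp ?_) hv
  refine inner_eq_zero_of_mem_supportL2 (fun m hm hmS => ?_) hw
  refine inner_toL2_wordProd_eq_zero hfree hm hl fun h => hS ?_
  rw [← hlS, ← hmS, h]

theorem starProjection_supportL2_empty {v : τ.L2} (h1 : inner ℂ v (τ.toL2 1) = 0) :
    (τ.supportL2 B ∅).starProjection v = 0 := by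
  rw [Submodule.starProjection_apply_eq_zero_iff, Submodule.mem_orthogonal]
  intro w hw
  refine inner_eq_zero_of_mem_supportL2 (fun m hm hmS => ?_) hw
  obtain rfl : m = [] := by simpa using hmS
  exact inner_eq_zero_symm.mp h1

variable [Fintype ι]

theorem sum_starProjection_supportL2 (hfree : τ.FreeSubalgebras B) {T : Set ι} {v : τ.L2}
    (hv : v ∈ τ.closureL2 (altSpan (fun i => (B i).toSubalgebra) τ.toLinearMap T)) :
    ∑ S, (τ.supportL2 B S).starProjection v = v := by
  have h := closureL2_le (τ := τ) (S := altSpan (fun i => (B i).toSubalgebra) τ.toLinearMap T)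
    (K := LinearMap.ker ((∑ S, (τ.supportL2 B S).starProjection - ContinuousLinearMap.id ℂ τ.L2 :
      τ.L2 →L[ℂ] τ.L2) : τ.L2 →ₗ[ℂ] τ.L2)) (ContinuousLinearMap.isClosed_ker _) ?_ hv
  · rw [LinearMap.mem_ker] at h
    simpa [sub_eq_zero] using h
  · intro p hp
    induction hp using Submodule.span_induction with
    | zero => simp
    | add p q _ _ hp hq => rw [map_add]; exact add_mem hp hq
    | smul c p _ hp => rw [map_smul]; exact Submodule.smul_mem _ _ hp
    | mem p hp =>
      obtain ⟨l, hl, -, rfl⟩ := hp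
      rw [LinearMap.mem_ker]
      simp only [ContinuousLinearMap.coe_coe, sub_apply,
        sum_apply, ContinuousLinearMap.id_apply, sub_eq_zero]
      rw [Finset.sum_eq_single (l.map Prod.fst).toFinset]
      · exact Submodule.starProjection_eq_self_iff.mpr (toL2_wordProd_mem_supportL2 hl)
      · intro S _ hS
        rw [Submodule.starProjection_apply_eq_zero_iff, Submodule.mem_orthogonal]
        intro w hw
        exact (orthogonalFamily_supportL2 hfree) hS ⟨w, hw⟩ ⟨_, toL2_wordProd_mem_supportL2 hl⟩
      · simp

/-- The variance inequality with its defect, for vectors `v j` in `L²` of the algebra generated by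
the `B i` with `i ≠ j`. -/
theorem norm_sq_sum_le_of_free (hfree : τ.FreeSubalgebras B) {v : ι → τ.L2}
    (hv : ∀ j, v j ∈ τ.closureL2 (altSpan (fun i => (B i).toSubalgebra) τ.toLinearMap {j}ᶜ)) :
    ‖∑ j, v j‖ ^ 2 + ∑ S : Finset ι, ((S.card : ℝ) - 1) *
      ∑ j, ‖(τ.supportL2 B S).starProjection (v j)‖ ^ 2 ≤
        ((Fintype.card ι : ℝ) - 1) * ∑ j, ‖v j‖ ^ 2 := by
  have h := norm_sq_sum_add_le (orthogonalFamily_supportL2 hfree)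
    (fun j S => (τ.supportL2 B S).starProjection (v j))
    (fun j S => Submodule.starProjection_apply_mem _ _) ?_
  · simpa only [sum_starProjection_supportL2 hfree (hv _)] using h
  · intro j S hj
    rw [Submodule.starProjection_apply_eq_zero_iff, Submodule.mem_orthogonal']
    intro w hw
    refine inner_eq_zero_of_mem_altSpan (fun l hl hlT => inner_eq_zero_symm.mp ?_) (hv j)
    refine inner_eq_zero_of_mem_supportL2 (fun m hm hmS => ?_) hw
    refine inner_toL2_wordProd_eq_zero hfree hm hl fun h => ?_
    rw [← hmS, h, List.mem_toFinset] at hj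
    obtain ⟨p, hp, rfl⟩ := List.mem_map.mp hj
    exact hlT p hp rfl

/-- The variance inequality for centered vectors `v j` in `L²` of the algebra generated by the `B i`
with `i ≠ j`. In case of equality, the sum has no component in longer words. -/
theorem norm_sq_sum_le (hfree : τ.FreeSubalgebras B) {v : ι → τ.L2}
    (hv : ∀ j, v j ∈ τ.closureL2 (altSpan (fun i => (B i).toSubalgebra) τ.toLinearMap {j}ᶜ))
    (h1 : ∀ j, inner ℂ (v j) (τ.toL2 1) = 0) :
    ‖∑ j, v j‖ ^ 2 ≤ ((Fintype.card ι : ℝ) - 1) * ∑ j, ‖v j‖ ^ 2 ∧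
      (‖∑ j, v j‖ ^ 2 = ((Fintype.card ι : ℝ) - 1) * ∑ j, ‖v j‖ ^ 2 →
        ∀ p q l, IsAltWord (fun i => (B i).toSubalgebra) τ.toLinearMap (p :: q :: l) →
          inner ℂ (∑ j, v j) (τ.toL2 (wordProd (p :: q :: l))) = 0) := by
  have h := norm_sq_sum_le_of_free hfree hv
  have hterm : ∀ S ∈ (Finset.univ : Finset (Finset ι)), 0 ≤ ((S.card : ℝ) - 1) *
      ∑ j, ‖(τ.supportL2 B S).starProjection (v j)‖ ^ 2 := by
    intro S _
    rcases S.eq_empty_or_nonempty with rfl | hS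
    · simp [fun j => starProjection_supportL2_empty (B := B) (h1 j)]
    · have : (1 : ℝ) ≤ S.card := by exact_mod_cast hS.card_pos
      exact mul_nonneg (by linarith) (Finset.sum_nonneg fun j _ => by positivity)
  have hsum := Finset.sum_nonneg hterm
  refine ⟨by linarith, fun heq p q l hl => ?_⟩
  have hz := (Finset.sum_eq_zero_iff_of_nonneg hterm).mp (by linarith)
    ((p :: q :: l).map Prod.fst).toFinset (Finset.mem_univ _)
  have hcard : 1 < ((p :: q :: l).map Prod.fst).toFinset.card := by
    refine Finset.one_lt_card.mpr ⟨p.1, by simp, q.1, by simp, ?_⟩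
    exact (List.isChain_cons.mp hl.1).1 q (by simp)
  have hcard' : (0 : ℝ) < ((p :: q :: l).map Prod.fst).toFinset.card - 1 := by
    rw [sub_pos]
    exact_mod_cast hcard
  have hz' := (mul_eq_zero.mp hz).resolve_left hcard'.ne'
  rw [sum_inner]
  refine Finset.sum_eq_zero fun j hj => ?_
  have hj0 := (Finset.sum_eq_zero_iff_of_nonneg (fun j _ => by positivity)).mp hz' j hj
  have hj1 := norm_eq_zero.mp (pow_eq_zero_iff (by norm_num) |>.mp hj0)
  rw [Submodule.starProjection_apply_eq_zero_iff] at hj1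
  exact inner_eq_zero_symm.mp (hj1 _ (toL2_wordProd_mem_supportL2 hl))

end TracialState

/-! ### Conjugate relations for weighted sums of a free family -/

theorem IsAltWord.mono {ι R : Type*} [Ring R] [Algebra ℂ R] {L L' : ι → Subalgebra ℂ R}
    {ε : R →ₗ[ℂ] ℂ} (h : ∀ i, L i ≤ L' i) {l : List (ι × R)} (hl : IsAltWord L ε l) :
    IsAltWord L' ε l :=
  ⟨hl.1, fun p hp => ⟨h _ (hl.2 p hp).1, (hl.2 p hp).2⟩⟩

namespace TracialState

variable {A : Type*} [Ring A] [StarRing A] [Algebra ℂ A] [StarModule ℂ A] {τ : TracialState A}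

theorem polyL2_smul_le (c : ℂ) (y : A) : τ.polyL2 (c • y) ≤ τ.polyL2 y := by
  refine closureL2_mono (Algebra.adjoin_le ?_)
  rintro _ rfl
  exact Subalgebra.smul_mem _ (Algebra.self_mem_adjoin_singleton ℂ y) c

theorem toL2_pow_mem_polyL2 (y : A) (k : ℕ) : τ.toL2 (y ^ k) ∈ τ.polyL2 y :=
  toL2_mem_closureL2 (pow_mem (Algebra.self_mem_adjoin_singleton ℂ y) k)

instance (y : A) : CompleteSpace (τ.polyL2 y) := by unfold polyL2; infer_instance

theorem ConjRel.starProjection {y : A} {ξ : τ.L2} (h : τ.ConjRel y ξ) :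
    τ.ConjRel y ((τ.polyL2 y).starProjection ξ) := by
  intro k
  rw [← h k, Submodule.inner_starProjection_left_eq_right,
    Submodule.starProjection_eq_self_iff.mpr (toL2_pow_mem_polyL2 y k)]

theorem ConjRel.unique {y : A} {ξ η : τ.L2} (hξ : ξ ∈ τ.polyL2 y) (hη : η ∈ τ.polyL2 y)
    (h : τ.ConjRel y ξ) (h' : τ.ConjRel y η) : ξ = η := by
  rw [← sub_eq_zero]
  refine eq_zero_of_mem_closureL2 (sub_mem hξ hη) fun q hq => ?_
  refine adjoin_singleton_induction (P := fun q => inner ℂ (ξ - η) (τ.toL2 q) = 0)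
    ?_ ?_ ?_ hq
  · intro a b ha hb; rw [map_add, inner_add_right, ha, hb, add_zero]
  · intro c a ha; rw [map_smul, inner_smul_right, ha, mul_zero]
  · intro k; rw [inner_sub_left, h k, h' k, sub_self]

theorem ConjRel.smul {y : A} {ξ : τ.L2} (h : τ.ConjRel y ξ) {c : ℝ} (hc : c ≠ 0) :
    τ.ConjRel ((c : ℂ) • y) (((c⁻¹ : ℝ) : ℂ) • ξ) := by
  intro k
  have hc' : (c : ℂ) ≠ 0 := by exact_mod_cast hc
  rw [smul_pow, map_smul, inner_smul_left, inner_smul_right, h k, Complex.conj_ofReal,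
    Finset.mul_sum, Finset.mul_sum]
  refine Finset.sum_congr rfl fun i hi => ?_
  have hi := Finset.mem_range.mp hi
  have e : (c : ℂ) ^ k = c * (c ^ i * c ^ (k - 1 - i)) := by
    rw [← pow_add, ← pow_succ']
    congr 1
    omega
  simp only [smul_pow, map_smul, smul_eq_mul]
  rw [e]
  push_cast
  field_simp

theorem not_conjRel_zero (ξ : τ.L2) : ¬ τ.ConjRel 0 ξ := by
  intro h
  simpa [τ.map_one] using h 1

theorem ConjRel.inner_one {y : A} {ξ : τ.L2} (h : τ.ConjRel y ξ) :
    inner ℂ ξ (τ.toL2 1) = 0 := by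
  simpa using h 0

theorem ConjRel.inner_self {y : A} {ξ : τ.L2} (h : τ.ConjRel y ξ) :
    inner ℂ ξ (τ.toL2 y) = 1 := by
  simpa [τ.map_one] using h 1

variable {ι : Type*} {x : ι → A} {a : ι → ℝ}

/-- The `*`-algebra generated by a single member of a family; for a self-adjoint member it consists
of the polynomials in it. -/
noncomputable abbrev singleAlg (x : ι → A) (i : ι) : StarSubalgebra ℂ A :=
  StarAlgebra.adjoin ℂ {x i}

theorem self_mem_singleAlg (i : ι) : x i ∈ singleAlg x i :=
  StarAlgebra.self_mem_adjoin_singleton ℂ (x i)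

theorem isSelfAdjoint_sum (hsa : ∀ i, IsSelfAdjoint (x i)) (s : Finset ι) :
    IsSelfAdjoint (∑ i ∈ s, (a i : ℂ) • x i) := by
  rw [IsSelfAdjoint, star_sum]
  refine Finset.sum_congr rfl fun i _ => ?_
  rw [star_smul, (hsa i).star_eq, Complex.star_def, Complex.conj_ofReal]

theorem sum_mem_groupAlg {T : Set ι} {s : Finset ι} (hs : ∀ i ∈ s, i ∈ T) :
    ∑ i ∈ s, (a i : ℂ) • x i ∈ groupAlg (fun i => (singleAlg x i).toSubalgebra) T :=
  sum_mem fun i hi => Subalgebra.smul_mem _ (mem_groupAlg (hs i hi) (self_mem_singleAlg i)) _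

theorem polyL2_sum_le {T : Set ι} {s : Finset ι} (hs : ∀ i ∈ s, i ∈ T) :
    τ.polyL2 (∑ i ∈ s, (a i : ℂ) • x i) ≤
      τ.closureL2 (altSpan (fun i => (singleAlg x i).toSubalgebra) τ.toLinearMap T) := by
  have h : Algebra.adjoin ℂ {∑ i ∈ s, (a i : ℂ) • x i} ≤
      groupAlg (fun i => (singleAlg x i).toSubalgebra) T := by
    refine Algebra.adjoin_le ?_
    rintro _ rfl
    exact sum_mem_groupAlg hs
  exact closureL2_mono fun p hp => groupAlg_le_altSpan τ.map_one (h hp)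

variable [Fintype ι] [DecidableEq ι]

/-- The conjugate relation for a partial sum of a free family implies the one for the whole sum. -/
theorem ConjRel.of_erase (hsa : ∀ i, IsSelfAdjoint (x i)) (hfree : τ.FreelyIndependent x) {j : ι}
    {ξ : τ.L2} (hξ : ξ ∈ τ.polyL2 (∑ i ∈ Finset.univ.erase j, (a i : ℂ) • x i))
    (h : τ.ConjRel (∑ i ∈ Finset.univ.erase j, (a i : ℂ) • x i) ξ) :
    τ.ConjRel (∑ i, (a i : ℂ) • x i) ξ := by
  rw [← Finset.sum_erase_add _ _ (Finset.mem_univ j)]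
  refine ConjRel.add (isSelfAdjoint_sum hsa _) (fun l hl hw => ?_) hξ h
  refine wordProd_group_eq_zero (L := fun i => (singleAlg x i).toSubalgebra)
    (fun i => decide (i ≠ j)) τ.map_one (FreeSubalgebras.map_wordProd hfree) l hl
    (hw.mono fun b => ?_)
  cases b with
  | true =>
    refine Algebra.adjoin_le (Set.singleton_subset_iff.mpr ?_)
    exact sum_mem_groupAlg (by simp)
  | false =>
    have hj : x j ∈ groupAlg (fun i => (singleAlg x i).toSubalgebra)
        ((fun i => decide (i ≠ j)) ⁻¹' {false}) :=
      mem_groupAlg (by simp) (self_mem_singleAlg j)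
    refine Algebra.adjoin_le (Set.singleton_subset_iff.mpr ?_)
    exact Subalgebra.smul_mem _ hj _

/-- The vectors of the space `L²` of the polynomials in `y` commute with `y`, expressed by testing
against elements of `A`. -/
theorem inner_toL2_mul_comm_of_mem_polyL2 {y : A} (hy : IsSelfAdjoint y) {V : τ.L2}
    (hV : V ∈ τ.polyL2 y) (p : A) :
    inner ℂ V (τ.toL2 (y * p)) = inner ℂ V (τ.toL2 (p * y)) := by
  rw [← sub_eq_zero, ← inner_sub_right, ← map_sub]
  refine inner_eq_zero_of_mem_closureL2 (fun q hq => ?_) hV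
  have hc : star q * y = y * star q := by
    refine adjoin_singleton_induction (P := fun r => r * y = y * r) ?_ ?_ ?_
      (star_mem_adjoin hy hq)
    · intro a b ha hb; rw [add_mul, mul_add, ha, hb]
    · intro c a ha; rw [smul_mul_assoc, mul_smul_comm, ha]
    · intro k; rw [← pow_succ, ← pow_succ']
  rw [inner_toL2, mul_sub, map_sub, ← mul_assoc, hc, mul_assoc, τ.map_mul_comm y, mul_assoc]
  exact sub_self _

section Rigidity

variable (hsa : ∀ i, IsSelfAdjoint (x i)) (hfree : τ.FreelyIndependent x)
  (hx : ∀ i, τ (x i) = 0) {V : τ.L2}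
  (hV : ∀ p q l, IsAltWord (fun i => (singleAlg x i).toSubalgebra) τ.toLinearMap (p :: q :: l) →
    inner ℂ V (τ.toL2 (wordProd (p :: q :: l))) = 0)

include hx hV in
/-- Multiplication by `x k` lengthens the word `u v` unless `k = i`, when the mean of `x i * u` is the
only contribution to a shorter word. -/
theorem inner_toL2_mul_mul_left {i j : ι} (hij : i ≠ j) {u v : A} (hu : u ∈ singleAlg x i)
    (hu0 : τ u = 0) (hv : v ∈ singleAlg x j) (hv0 : τ v = 0) (k : ι) :
    inner ℂ V (τ.toL2 (x k * (u * v))) =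
      if k = i then τ (x i * u) * inner ℂ V (τ.toL2 v) else 0 := by
  have hw : IsAltWord (fun i => (singleAlg x i).toSubalgebra) τ.toLinearMap [(j, v)] :=
    IsAltWord.nil.cons hv hv0 (by simp)
  split_ifs with hki
  · subst hki
    have h := hV (k, x k * u - algebraMap ℂ A (τ (x k * u))) (j, v) [] (hw.cons
      (sub_mem (mul_mem (self_mem_singleAlg k) hu) (Subalgebra.algebraMap_mem _ _))
      (by simp [Algebra.algebraMap_eq_smul_one, τ.map_one]) (by simpa using hij))
    rw [← inner_smul_right, ← map_smul, ← sub_eq_zero, ← inner_sub_right, ← map_sub]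
    simpa [sub_mul, Algebra.algebraMap_eq_smul_one, mul_assoc] using h
  · have h := hV (k, x k) (i, u) [(j, v)] ((hw.cons (p := (i, u)) hu hu0 (by simpa using hij)).cons
      (self_mem_singleAlg k) (hx k) (by simpa using hki))
    simpa using h

include hx hV in
theorem inner_toL2_mul_mul_right {i j : ι} (hij : i ≠ j) {u v : A} (hu : u ∈ singleAlg x i)
    (hu0 : τ u = 0) (hv : v ∈ singleAlg x j) (hv0 : τ v = 0) (k : ι) :
    inner ℂ V (τ.toL2 (u * v * x k)) =
      if k = j then τ (v * x j) * inner ℂ V (τ.toL2 u) else 0 := by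
  split_ifs with hkj
  · subst hkj
    have hw : IsAltWord (fun i => (singleAlg x i).toSubalgebra) τ.toLinearMap
        [(k, v * x k - algebraMap ℂ A (τ (v * x k)))] :=
      IsAltWord.nil.cons
        (sub_mem (mul_mem hv (self_mem_singleAlg k)) (Subalgebra.algebraMap_mem _ _))
        (by simp [Algebra.algebraMap_eq_smul_one, τ.map_one]) (by simp)
    have h := hV (i, u) _ [] (hw.cons hu hu0 (by simpa using hij))
    rw [← inner_smul_right, ← map_smul, ← sub_eq_zero, ← inner_sub_right, ← map_sub]
    simpa [mul_sub, Algebra.algebraMap_eq_smul_one, mul_assoc] using h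
  · have hw : IsAltWord (fun i => (singleAlg x i).toSubalgebra) τ.toLinearMap [(k, x k)] :=
      IsAltWord.nil.cons (self_mem_singleAlg k) (hx k) (by simp)
    have h := hV (i, u) (j, v) [(k, x k)] ((hw.cons (p := (j, v)) hv hv0
      (by simpa [eq_comm] using hkj)).cons hu hu0 (by simpa using hij))
    simpa [mul_assoc] using h

include hsa hx hV in
/-- Comparing the components of `S V = V S` in the words with two labels `i ≠ j`. -/
theorem mul_inner_eq_mul_inner (hVS : V ∈ τ.polyL2 (∑ i, (a i : ℂ) • x i)) {i j : ι} (hij : i ≠ j)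
    {u v : A} (hu : u ∈ singleAlg x i) (hu0 : τ u = 0) (hv : v ∈ singleAlg x j) (hv0 : τ v = 0) :
    a i * (τ (x i * u) * inner ℂ V (τ.toL2 v)) = a j * (τ (v * x j) * inner ℂ V (τ.toL2 u)) := by
  have h := inner_toL2_mul_comm_of_mem_polyL2 (isSelfAdjoint_sum hsa _) hVS (u * v)
  simpa [Finset.sum_mul, Finset.mul_sum, inner_sum, inner_smul_right,
    inner_toL2_mul_mul_left hx hV hij hu hu0 hv hv0,
    inner_toL2_mul_mul_right hx hV hij hu hu0 hv hv0] using h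

include hsa hfree hx in
theorem inner_sum_toL2 {j : ι} {v : A} (hv : v ∈ singleAlg x j) (hv0 : τ v = 0) :
    inner ℂ (τ.toL2 (∑ i, (a i : ℂ) • x i)) (τ.toL2 v) = a j * τ (x j * v) := by
  rw [map_sum, sum_inner, Finset.sum_eq_single j]
  · rw [map_smul, inner_smul_left, inner_toL2, (hsa j).star_eq, Complex.conj_ofReal]
  · intro i _ hij
    have h := inner_toL2_wordProd_eq_zero (τ := τ) hfree (l := [(i, x i)]) (m := [(j, v)])
      (IsAltWord.nil.cons (self_mem_singleAlg i) (hx i) (by simp))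
      (IsAltWord.nil.cons hv hv0 (by simp)) (by simpa using hij)
    rw [map_smul, inner_smul_left]
    simp only [wordProd_cons, wordProd_nil, mul_one] at h
    rw [h, mul_zero]
  · simp

include hsa hfree hx hV in
/-- A centered vector of the space `L²` of the polynomials in `S = ∑ aᵢ xᵢ` without components in
longer words is a multiple of `S`. -/
theorem eq_smul_toL2_sum (hVS : V ∈ τ.polyL2 (∑ i, (a i : ℂ) • x i))
    (hV1 : inner ℂ V (τ.toL2 1) = 0) {g : ℂ} (hg : g ≠ 0) (hxg : ∀ i, τ (x i * x i) = g)
    (ha : ∀ j, ∃ i, i ≠ j ∧ a i ≠ 0) [Nonempty ι] :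
    ∃ c : ℂ, V = c • τ.toL2 (∑ i, (a i : ℂ) • x i) := by
  -- Each of two labels `i`, `k` with nonzero coefficients fixes the components of `V` at all other
  -- labels, with the same factor.
  obtain ⟨i, -, hi⟩ := ha (Classical.arbitrary ι)
  obtain ⟨k, hki, hk⟩ := ha i
  have hi' : (a i : ℂ) ≠ 0 := by exact_mod_cast hi
  have hk' : (a k : ℂ) ≠ 0 := by exact_mod_cast hk
  set μ : ℂ := inner ℂ V (τ.toL2 (x i)) / (a i * g) with hμ
  have hμ' : inner ℂ V (τ.toL2 (x i)) = μ * (a i * g) := by rw [hμ]; field_simp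
  have h1 : ∀ j, j ≠ i → ∀ v ∈ singleAlg x j, τ v = 0 →
      inner ℂ V (τ.toL2 v) = μ * (a j * τ (x j * v)) := by
    intro j hj v hv hv0
    have h := mul_inner_eq_mul_inner hsa hx hV hVS hj.symm (self_mem_singleAlg i) (hx i) hv hv0
    rw [hxg, hμ', τ.map_mul_comm v] at h
    have hne : (a i : ℂ) * g ≠ 0 := mul_ne_zero hi' hg
    refine mul_left_cancel₀ hne ?_
    linear_combination h
  have h2 : ∀ j, ∀ v ∈ singleAlg x j, τ v = 0 →
      inner ℂ V (τ.toL2 v) = μ * (a j * τ (x j * v)) := by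
    intro j v hv hv0
    by_cases hj : j = i
    · subst hj
      have h := mul_inner_eq_mul_inner hsa hx hV hVS hki (self_mem_singleAlg k) (hx k) hv hv0
      rw [hxg, h1 k hki _ (self_mem_singleAlg k) (hx k), hxg, τ.map_mul_comm v] at h
      have hne : (a k : ℂ) * g ≠ 0 := mul_ne_zero hk' hg
      refine mul_left_cancel₀ hne ?_
      linear_combination h
    · exact h1 j hj v hv hv0
  refine ⟨starRingEnd ℂ μ, ?_⟩
  have hS : τ.toL2 (∑ i, (a i : ℂ) • x i) ∈ τ.polyL2 (∑ i, (a i : ℂ) • x i) := by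
    simpa using toL2_pow_mem_polyL2 (τ := τ) (∑ i, (a i : ℂ) • x i) 1
  have hmem := polyL2_sum_le (T := Set.univ) (s := Finset.univ) (by simp)
    (sub_mem hVS (Submodule.smul_mem _ (starRingEnd ℂ μ) hS))
  rw [← sub_eq_zero, ← inner_self_eq_zero (𝕜 := ℂ)]
  refine inner_eq_zero_of_mem_altSpan (fun l hl _ => inner_eq_zero_symm.mp ?_) hmem
  rw [inner_sub_left, inner_smul_left, Complex.conj_conj]
  match l, hl with
  | [], _ =>
    have h0 : τ (∑ i, (a i : ℂ) • x i) = 0 := by simp [hx]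
    rw [wordProd_nil, hV1, inner_toL2, (isSelfAdjoint_sum hsa _).star_eq, mul_one, h0]
    simp
  | [(j, v)], hl =>
    have hv := hl.2 _ List.mem_cons_self
    simp only [wordProd_cons, wordProd_nil, mul_one]
    rw [h2 j v hv.1 hv.2, inner_sum_toL2 hsa hfree hx hv.1 hv.2, sub_self]
  | p :: q :: l, hl =>
    rw [hV p q l hl, map_sum, sum_inner, Finset.sum_eq_zero, mul_zero, sub_zero]
    intro k _
    have h := inner_toL2_wordProd_eq_zero (τ := τ) hfree (l := [(k, x k)])
      (IsAltWord.nil.cons (self_mem_singleAlg k) (hx k) (by simp)) hl (by simp)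
    rw [map_smul, inner_smul_left]
    simp only [wordProd_cons (k, x k), wordProd_nil, mul_one] at h
    rw [h, mul_zero]

include hsa hfree hx hV in
/-- If the conjugate variable of `S = ∑ aᵢ xᵢ` has no components in longer words, then it is a
multiple of `S`. -/
theorem conjRel_smul_toL2_sum (hVS : V ∈ τ.polyL2 (∑ i, (a i : ℂ) • x i))
    (hrel : τ.ConjRel (∑ i, (a i : ℂ) • x i) V) {γ : ℝ} (hγ : 0 < γ)
    (hxg : ∀ i, τ (x i * x i) = (γ : ℂ)) (ha : ∑ i, a i ^ 2 = 1)
    (hane : ∀ j, ∃ i, i ≠ j ∧ a i ≠ 0) [Nonempty ι] :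
    τ.ConjRel (∑ i, (a i : ℂ) • x i) (((γ⁻¹ : ℝ) : ℂ) • τ.toL2 (∑ i, (a i : ℂ) • x i)) := by
  have hγ' : (γ : ℂ) ≠ 0 := by exact_mod_cast hγ.ne'
  obtain ⟨c, hc⟩ := eq_smul_toL2_sum hsa hfree hx hV hVS hrel.inner_one hγ' hxg hane
  have h1 : ∀ j, inner ℂ (τ.toL2 (∑ i, (a i : ℂ) • x i)) (τ.toL2 ((a j : ℂ) • x j)) =
      ((a j ^ 2 : ℝ) : ℂ) * (γ : ℂ) := by
    intro j
    rw [map_smul, inner_smul_right, inner_sum_toL2 hsa hfree hx (self_mem_singleAlg j) (hx j),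
      hxg j]
    push_cast
    ring
  have hSS : inner ℂ (τ.toL2 (∑ i, (a i : ℂ) • x i)) (τ.toL2 (∑ i, (a i : ℂ) • x i)) =
      (γ : ℂ) := by
    nth_rewrite 2 [map_sum]
    rw [inner_sum]
    simp only [h1]
    rw [← Finset.sum_mul, ← Complex.ofReal_sum, ha, Complex.ofReal_one, one_mul]
  have hc' : c = ((γ⁻¹ : ℝ) : ℂ) := by
    have h := hrel.inner_self
    rw [hc, inner_smul_left, hSS] at h
    rw [← Complex.conj_conj c, eq_inv_of_mul_eq_one_left h, ← Complex.ofReal_inv,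
      Complex.conj_ofReal]
  rwa [hc, hc'] at hrel

end Rigidity

/-- If a multiple of `y` satisfies the conjugate relation, then `y` is semicircular. -/
theorem ConjRel.isSemicircular {y : A} (hy : IsSelfAdjoint y) {γ : ℝ} (hγ : 0 < γ)
    (h : τ.ConjRel y (((γ⁻¹ : ℝ) : ℂ) • τ.toL2 y)) : τ.IsSemicircular y 0 γ := by
  refine ⟨hγ, isProbabilityMeasure_semicircleLaw hγ, ⟨2 * √γ, semicircleLaw_compl_Icc γ⟩,
    integral_pow_semicircleLaw_eq hγ (m := fun k => τ (y ^ k)) ?_ fun k => ?_⟩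
  · rw [pow_zero, τ.map_one]
  · have hk := h k
    have hγ' : (γ : ℂ) ≠ 0 := by exact_mod_cast hγ.ne'
    rw [inner_smul_left, inner_toL2, hy.star_eq, ← pow_succ', Complex.conj_ofReal] at hk
    rw [← hk]
    push_cast
    field_simp

end TracialState

/-! ### Free Fisher information -/

namespace TracialState

variable {H : Type*} [NormedAddCommGroup H] [InnerProductSpace ℂ H] [CompleteSpace H]
  {M : VonNeumannAlgebra H} {τ : TracialState M.toStarSubalgebra}

theorem isConjugateVariable_iff {y : M.toStarSubalgebra} {ξ : τ.L2} :
    τ.IsConjugateVariable y ξ ↔ ξ ∈ τ.L2Generated y ∧ τ.ConjRel y ξ := by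
  refine and_congr_right fun _ => forall_congr' fun k => ?_
  rw [freeDiff_X_pow, map_sum, inner_sum]
  refine Eq.congr rfl (Finset.sum_congr rfl fun i _ => ?_)
  rw [TensorProduct.map_tmul, TensorProduct.inner_tmul]
  simp [evalL2, inner_toL2]

theorem mem_vonNeumannGenerated_self (y : H →L[ℂ] H) : y ∈ vonNeumannGenerated {y} := by
  change y ∈ StarSubalgebra.centralizer ℂ
    ((StarSubalgebra.centralizer ℂ {y} : StarSubalgebra ℂ (H →L[ℂ] H)) : Set (H →L[ℂ] H))
  rw [StarSubalgebra.mem_centralizer_iff]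
  intro g hg
  have hg' := (StarSubalgebra.mem_centralizer_iff ℂ).mp hg y rfl
  have hg'' := (StarSubalgebra.mem_centralizer_iff ℂ).mp (star_mem hg) y rfl
  exact ⟨hg'.1.symm, hg''.1.symm⟩

theorem polyL2_subset_L2Generated (y : M.toStarSubalgebra) :
    (τ.polyL2 y : Set τ.L2) ⊆ τ.L2Generated y := by
  refine closure_mono ?_
  rintro _ ⟨p, hp, rfl⟩
  refine ⟨p, ?_, rfl⟩
  have h : Algebra.adjoin ℂ {y} ≤ ((vonNeumannGenerated {(y : H →L[ℂ] H)}).toStarSubalgebra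
      |>.toSubalgebra).comap M.toStarSubalgebra.toSubalgebra.val := by
    refine Algebra.adjoin_le (Set.singleton_subset_iff.mpr ?_)
    exact mem_vonNeumannGenerated_self (y : H →L[ℂ] H)
  exact h hp

theorem ConjRel.isConjugateVariable {y : M.toStarSubalgebra} {ξ : τ.L2} (h : τ.ConjRel y ξ)
    (hξ : ξ ∈ τ.polyL2 y) : τ.IsConjugateVariable y ξ :=
  isConjugateVariable_iff.mpr ⟨polyL2_subset_L2Generated y hξ, h⟩

/-- A vector that satisfies the conjugate relation determines the free Fisher information by
projection onto `L²` of the polynomials in `y`. -/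
theorem ConjRel.freeFisher_eq {y : M.toStarSubalgebra} {ξ : τ.L2} (h : τ.ConjRel y ξ) :
    τ.freeFisher y = ‖(τ.polyL2 y).starProjection ξ‖ₑ ^ 2 := by
  have hmem : ∀ η : τ.L2, (τ.polyL2 y).starProjection η ∈ τ.polyL2 y :=
    fun η => Submodule.starProjection_apply_mem _ _
  refine le_antisymm (iInf₂_le _ (h.starProjection.isConjugateVariable (hmem ξ))) ?_
  refine le_iInf₂ fun η hη => ?_
  have hη' := (isConjugateVariable_iff.mp hη).2
  rw [h.starProjection.unique (hmem ξ) (hmem η) hη'.starProjection]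
  gcongr
  rw [enorm_le_iff_norm_le]
  exact Submodule.norm_starProjection_apply_le _ _

theorem exists_conjRel_of_freeFisher_lt_top {y : M.toStarSubalgebra} (h : τ.freeFisher y < ⊤) :
    ∃ ξ ∈ τ.polyL2 y, τ.ConjRel y ξ ∧ τ.freeFisher y = ‖ξ‖ₑ ^ 2 := by
  obtain ⟨ξ, hξ, -⟩ := by simpa only [freeFisher, iInf_lt_iff] using h
  have hξ' := (isConjugateVariable_iff.mp hξ).2
  exact ⟨_, Submodule.starProjection_apply_mem _ _, hξ'.starProjection, hξ'.freeFisher_eq⟩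

theorem freeFisher_zero : τ.freeFisher 0 = ⊤ := by
  by_contra h
  obtain ⟨ξ, -, hξ, -⟩ := exists_conjRel_of_freeFisher_lt_top (lt_top_iff_ne_top.mpr h)
  exact not_conjRel_zero ξ hξ

theorem ConjRel.freeFisher_lt_top {y : M.toStarSubalgebra} {ξ : τ.L2} (h : τ.ConjRel y ξ) :
    τ.freeFisher y < ⊤ := by
  rw [h.freeFisher_eq]
  exact ENNReal.pow_lt_top enorm_lt_top

theorem enorm_sq_eq_ofReal {E : Type*} [SeminormedAddGroup E] (v : E) :
    ‖v‖ₑ ^ 2 = ENNReal.ofReal (‖v‖ ^ 2) := by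
  rw [← ofReal_norm, ENNReal.ofReal_pow (norm_nonneg _)]

section Sum

variable {ι : Type*} [Fintype ι] [DecidableEq ι] {x : ι → M.toStarSubalgebra} {a b : ι → ℝ}

/-- The conjugate variables of the normalized partial sums, multiplied by the coefficients `b j`,
add up to a vector that satisfies the conjugate relation for the whole sum. -/
theorem exists_conjRel_sum (hsa : ∀ j, IsSelfAdjoint (x j)) (hfree : τ.FreelyIndependent x)
    (hb : ∑ j, b j * √(1 - a j ^ 2) = 1)
    (hfin : ∀ j, b j ≠ 0 → τ.freeFisher (((1 / √(1 - a j ^ 2) : ℝ) : ℂ) •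
      ∑ i ∈ Finset.univ.erase j, (a i : ℂ) • x i) < ⊤) :
    ∃ v : ι → τ.L2,
      (∀ j, v j ∈ τ.closureL2
        (altSpan (fun i => (singleAlg x i).toSubalgebra) τ.toLinearMap {j}ᶜ)) ∧
      (∀ j, inner ℂ (v j) (τ.toL2 1) = 0) ∧
      τ.ConjRel (∑ j, (a j : ℂ) • x j) (∑ j, v j) ∧
      ∑ j, ENNReal.ofReal (b j ^ 2) * τ.freeFisher (((1 / √(1 - a j ^ 2) : ℝ) : ℂ) •
          ∑ i ∈ Finset.univ.erase j, (a i : ℂ) • x i) =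
        ENNReal.ofReal (∑ j, ‖v j‖ ^ 2) := by
  have key : ∀ j, ∃ v : τ.L2,
      v ∈ τ.closureL2 (altSpan (fun i => (singleAlg x i).toSubalgebra) τ.toLinearMap {j}ᶜ) ∧
      inner ℂ v (τ.toL2 1) = 0 ∧
      (∀ k : ℕ, inner ℂ v (τ.toL2 ((∑ j, (a j : ℂ) • x j) ^ k)) =
        (b j * √(1 - a j ^ 2) : ℝ) * ∑ i ∈ Finset.range k, τ ((∑ j, (a j : ℂ) • x j) ^ i) *
          τ ((∑ j, (a j : ℂ) • x j) ^ (k - 1 - i))) ∧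
      ENNReal.ofReal (b j ^ 2) * τ.freeFisher (((1 / √(1 - a j ^ 2) : ℝ) : ℂ) •
          ∑ i ∈ Finset.univ.erase j, (a i : ℂ) • x i) = ENNReal.ofReal (‖v‖ ^ 2) := by
    intro j
    by_cases hbj : b j = 0
    · exact ⟨0, zero_mem _, by simp, by simp [hbj], by simp [hbj]⟩
    · have hlt := hfin j hbj
      obtain ⟨ξ, hξ, hrel, hF⟩ := exists_conjRel_of_freeFisher_lt_top hlt
      have hs : √(1 - a j ^ 2) ≠ 0 := by
        intro h0
        rw [h0, div_zero, Complex.ofReal_zero, zero_smul, freeFisher_zero] at hlt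
        exact lt_irrefl _ hlt
      set y := ∑ i ∈ Finset.univ.erase j, (a i : ℂ) • x i with hy
      have hξy := polyL2_smul_le _ _ hξ
      have hrel' : τ.ConjRel y ((((√(1 - a j ^ 2))⁻¹ : ℝ) : ℂ) • ξ) := by
        have h := hrel.smul hs
        rw [smul_smul, ← Complex.ofReal_mul, mul_one_div_cancel hs, Complex.ofReal_one,
          one_smul] at h
        exact h
      have hS := ConjRel.of_erase hsa hfree
        (Submodule.smul_mem _ _ hξy) hrel'
      refine ⟨(b j : ℂ) • ξ, Submodule.smul_mem _ _ (polyL2_sum_le (by simp) hξy), ?_, ?_, ?_⟩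
      · rw [inner_smul_left, hrel.inner_one, mul_zero]
      · intro k
        rw [← hS k, inner_smul_left, inner_smul_left, Complex.conj_ofReal, Complex.conj_ofReal,
          ← mul_assoc, ← Complex.ofReal_mul, mul_inv_cancel_right₀ hs]
      · rw [hF, enorm_sq_eq_ofReal, ← ENNReal.ofReal_mul (sq_nonneg _), norm_smul, mul_pow,
          Complex.norm_real, Real.norm_eq_abs, sq_abs]
  choose v h1 h2 h3 h4 using key
  refine ⟨v, h1, h2, fun k => ?_, ?_⟩
  · rw [sum_inner]
    simp only [h3]
    rw [← Finset.sum_mul, ← Complex.ofReal_sum, hb, Complex.ofReal_one, one_mul]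
  · simp only [h4]
    rw [ENNReal.ofReal_sum_of_nonneg fun j _ => by positivity]

/-- The variance inequality for a vector `∑ j, v j` that satisfies the conjugate relation of `y`. In
case of equality this vector is the conjugate variable of `y`, and it has no components in longer
words. -/
theorem freeFisher_sum_le (hfree : τ.FreelyIndependent x) {v : ι → τ.L2}
    (hv : ∀ j, v j ∈ τ.closureL2
      (altSpan (fun i => (singleAlg x i).toSubalgebra) τ.toLinearMap {j}ᶜ))
    (hv1 : ∀ j, inner ℂ (v j) (τ.toL2 1) = 0) {y : M.toStarSubalgebra}
    (hrel : τ.ConjRel y (∑ j, v j)) {n : ℕ} (hn : Fintype.card ι = n + 1) :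
    τ.freeFisher y ≤ n * ENNReal.ofReal (∑ j, ‖v j‖ ^ 2) ∧
      (τ.freeFisher y = n * ENNReal.ofReal (∑ j, ‖v j‖ ^ 2) →
        ∑ j, v j ∈ τ.polyL2 y ∧ ∀ p q l,
          IsAltWord (fun i => (singleAlg x i).toSubalgebra) τ.toLinearMap (p :: q :: l) →
            inner ℂ (∑ j, v j) (τ.toL2 (wordProd (p :: q :: l))) = 0) := by
  obtain ⟨hle, hequal⟩ := norm_sq_sum_le hfree hv hv1
  rw [hn, Nat.cast_add_one, add_sub_cancel_right] at hle hequal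
  have hsum : 0 ≤ ∑ j, ‖v j‖ ^ 2 := Finset.sum_nonneg fun j _ => by positivity
  rw [hrel.freeFisher_eq, enorm_sq_eq_ofReal, ← ENNReal.ofReal_natCast,
    ← ENNReal.ofReal_mul (Nat.cast_nonneg n)]
  generalize ∑ j, v j = V at *
  have hproj := pow_le_pow_left₀ (norm_nonneg _)
    (Submodule.norm_starProjection_apply_le (τ.polyL2 y) V) 2
  refine ⟨ENNReal.ofReal_le_ofReal (hproj.trans hle), fun heq => ?_⟩
  rw [ENNReal.ofReal_eq_ofReal_iff (by positivity) (mul_nonneg (Nat.cast_nonneg n) hsum)] at heq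
  refine ⟨?_, hequal (by linarith)⟩
  rw [Submodule.mem_iff_norm_starProjection]
  exact (pow_left_inj₀ (norm_nonneg _) (norm_nonneg _) two_ne_zero).mp (by linarith)

end Sum

end TracialState

theorem mainTheorem3 {H : Type*} [NormedAddCommGroup H] [InnerProductSpace ℂ H] [CompleteSpace H]
    (M : VonNeumannAlgebra H) (τ : TracialState M.toStarSubalgebra) (hτ : τ.IsNormal)
    (n : ℕ) (x : Fin (n + 1) → M.toStarSubalgebra)
    (hsa : ∀ j, IsSelfAdjoint (x j)) (hfree : τ.FreelyIndependent x)
    (hcentered : ∀ j, τ (x j) = 0) (hnorm : ∀ j, ‖τ.toL2 (x j)‖ = ‖τ.toL2 (x 0)‖)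
    (a b : Fin (n + 1) → ℝ) (ha : ∑ j, a j ^ 2 = 1) (hb : ∑ j, b j * √(1 - a j ^ 2) = 1) :
    τ.freeFisher (∑ j, (a j : ℂ) • x j) ≤
        n * ∑ j, ENNReal.ofReal (b j ^ 2) *
          τ.freeFisher (((1 / √(1 - a j ^ 2) : ℝ) : ℂ) •
            ∑ i ∈ Finset.univ.erase j, (a i : ℂ) • x i) ∧
      ((∀ j, τ.freeFisher (∑ i ∈ Finset.univ.erase j, (a i : ℂ) • x i) < ⊤) →
        τ.freeFisher (∑ j, (a j : ℂ) • x j) =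
          n * ∑ j, ENNReal.ofReal (b j ^ 2) *
            τ.freeFisher (((1 / √(1 - a j ^ 2) : ℝ) : ℂ) •
              ∑ i ∈ Finset.univ.erase j, (a i : ℂ) • x i) →
        τ.IsConjugateVariable (((1 / ‖τ.toL2 (x 0)‖ : ℝ) : ℂ) • ∑ j, (a j : ℂ) • x j)
            (τ.toL2 (((1 / ‖τ.toL2 (x 0)‖ : ℝ) : ℂ) • ∑ j, (a j : ℂ) • x j)) ∧
          τ.IsSemicircular (∑ j, (a j : ℂ) • x j) 0 (‖τ.toL2 (x 0)‖ ^ 2)) := by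
  refine ⟨?_, fun hfin heq => ?_⟩
  · by_cases hfin : ∀ j, b j ≠ 0 → τ.freeFisher (((1 / √(1 - a j ^ 2) : ℝ) : ℂ) •
        ∑ i ∈ Finset.univ.erase j, (a i : ℂ) • x i) < ⊤
    · obtain ⟨v, hv, hv1, hrel, hsum⟩ := TracialState.exists_conjRel_sum hsa hfree hb hfin
      rw [hsum]
      exact (TracialState.freeFisher_sum_le hfree hv hv1 hrel (Fintype.card_fin _)).1
    · push Not at hfin
      obtain ⟨j, hbj, htop⟩ := hfin
      -- For `n = 0` the hypotheses on `a` and `b` contradict each other.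
      have hn : n ≠ 0 := by
        rintro rfl
        simp only [Fin.sum_univ_succ, Finset.univ_eq_empty, Finset.sum_empty, add_zero] at ha hb
        simp [ha] at hb
      have hpos : ENNReal.ofReal (b j ^ 2) ≠ 0 := by
        rw [Ne, ENNReal.ofReal_eq_zero, not_le]
        positivity
      have hsum : ∑ j, ENNReal.ofReal (b j ^ 2) * τ.freeFisher (((1 / √(1 - a j ^ 2) : ℝ) : ℂ) •
          ∑ i ∈ Finset.univ.erase j, (a i : ℂ) • x i) = ⊤ := by
        refine ENNReal.sum_eq_top.mpr ⟨j, Finset.mem_univ j, ?_⟩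
        rw [top_le_iff.mp htop, ENNReal.mul_top hpos]
      rw [hsum, ENNReal.mul_top (by exact_mod_cast hn)]
      exact le_top
  · -- Every partial sum is nonzero, since the free Fisher information of `0` is infinite.
    set r := ‖τ.toL2 (x 0)‖ with hr
    have hane : ∀ j, ∃ i, i ≠ j ∧ a i ≠ 0 ∧ x i ≠ 0 := by
      intro j
      by_contra! h
      have h0 : ∑ i ∈ Finset.univ.erase j, (a i : ℂ) • x i = 0 := by
        refine Finset.sum_eq_zero fun i hi => ?_
        by_cases hai : a i = 0
        · simp [hai]
        · rw [h i (Finset.ne_of_mem_erase hi) hai, smul_zero]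
      have := hfin j
      rw [h0, TracialState.freeFisher_zero] at this
      exact lt_irrefl _ this
    have hxx : ∀ i, τ (x i * x i) = ((r ^ 2 : ℝ) : ℂ) := by
      intro i
      have h := inner_self_eq_norm_sq_to_K (𝕜 := ℂ) (τ.toL2 (x i))
      rw [TracialState.inner_toL2, (hsa i).star_eq, hnorm i] at h
      rw [h]
      simp [hr]
    have hr0 : 0 < r := by
      obtain ⟨i, -, -, hi⟩ := hane 0
      refine lt_of_le_of_ne (norm_nonneg _) fun h0 => hi ?_
      refine τ.faithful' _ ?_
      have h1 := hxx i
      rw [← h0] at h1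
      rw [(hsa i).star_eq]
      simpa using h1
    have hs : ∀ j, √(1 - a j ^ 2) ≠ 0 := by
      intro j
      obtain ⟨i, hij, hai, -⟩ := hane j
      have h1 := Finset.add_le_sum (f := fun i => a i ^ 2) (fun i _ => sq_nonneg (a i))
        (Finset.mem_univ i) (Finset.mem_univ j) hij
      have h2 : 0 < a i ^ 2 := by positivity
      refine (Real.sqrt_pos.mpr ?_).ne'
      linarith
    obtain ⟨v, hv, hv1, hrel, hsum⟩ := TracialState.exists_conjRel_sum hsa hfree hb (by
      intro j _
      obtain ⟨ξ, -, hξ, -⟩ := TracialState.exists_conjRel_of_freeFisher_lt_top (hfin j)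
      exact (hξ.smul (one_div_ne_zero (hs j))).freeFisher_lt_top)
    rw [hsum] at heq
    obtain ⟨hVS, hV⟩ :=
      (TracialState.freeFisher_sum_le hfree hv hv1 hrel (Fintype.card_fin _)).2 heq
    have hrel' := TracialState.conjRel_smul_toL2_sum hsa hfree hcentered hV hVS hrel
      (pow_pos hr0 2) hxx ha (fun j => (hane j).imp fun i hi => ⟨hi.1, hi.2.1⟩)
    refine ⟨?_, hrel'.isSemicircular (TracialState.isSelfAdjoint_sum hsa _) (by positivity)⟩
    have h := hrel'.smul (one_div_ne_zero hr0.ne')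
    rw [smul_smul, ← Complex.ofReal_mul, show (1 / r)⁻¹ * (r ^ 2)⁻¹ = 1 / r by field_simp,
      ← map_smul] at h
    refine h.isConjugateVariable ?_
    simpa using TracialState.toL2_pow_mem_polyL2 (τ := τ) 
      (((1 / r : ℝ) : ℂ) • ∑ j, (a j : ℂ) • x j) 1
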